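/- **Setting.** Consider an $N$-player stochastic hierarchical game. Player $j$ chooses $x^j$ in a nonempty closed convex set $\mathcal X_j\subseteq\mathbb R^{n_j}$; write $\mathcal X=\prod_j\mathcal X_j$, and $x^{-i}$ for the decisions of the rivals of $i$. Let $\xi$ denote the random scenario. Fix a player $i$ with $n_i\ge 1$ and $\mathcal X_i$ bounded, and a number $\eta>0$. Let $\mathbb B$ and $\mathbb S$ be the closed unit ball and the unit sphere of $\mathbb R^{n_i}$. For $x^i\in\mathcal X_i+\eta\mathbb B$, $x^{-i}\in\prod_{j\ne i}\mathcal X_j$ and each $\xi$, let $y^i(x,\xi)$ be the unique solution of the lower-level variational inequality $\mathrm{VI}(\mathcal Y_i,F_i(\cdot,x,\xi))$, where $\mathcal Y_i$ is closed and convex (uniqueness is assumed). Put $$\tilde f_i(x,\xi)=\tilde g_i(x,\xi)+\tilde h_i(x^i,y^i(x,\xi),\xi),\qquad f_i(x)=\mathbb E[\tilde f_i(x,\xi)].$$ Assume that $\tilde f_i$ is jointly measurable, that $\mathbb E[\tilde f_i(x,\xi)^2]$ is bounded uniformly over $x^i\in\mathcal X_i+\eta\mathbb B$ and $x^{-i}\in\prod_{j\ne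 i}\mathcal X_j$, and that $f_i(\cdot,x^{-i})$ is $L_0$-Lipschitz on $\mathcal X_i+\eta\mathbb B$ for all such $x^{-i}$. For $c>0$ let $$f_{i,\eta}(x^i,x^{-i})=\mathbb E_{u}[f_i(x^i+\eta u,x^{-i})],\quad u\ \text{uniform on}\ \mathbb B,\qquad \phi_{i,\eta}(v,x)=f_{i,\eta}(v,x^{-i})+\tfrac c2\|v-x^i\|^2 ,$$ and assume that $\phi_{i,\eta}(\cdot,x)$ is $c$-strongly convex on $\mathcal X_i$ for every $x\in\mathcal X$. (By the Lipschitz assumption it is $\alpha$-smooth with $\alpha=\tfrac{L_0n_i}{\eta}+c$.) Let $v^{i,*}=v^{i,*}(x)$ be the minimizer of $\phi_{i,\eta}(\cdot,x)$ over $\mathcal X_i$. **Scheme (ZSOL).** Let $x$ be an $\mathcal X$-valued and $v^{i,0}$ an $\mathcal X_i$-valued random vector. Let $(\xi_{t,j},s_{t,j})$, $t,j\ge0$, be independent pairs, independent of $(x,v^{i,0})$, in which $\xi_{t,j}$ is distributed as $\xi$ and $s_{t,j}$ is uniformly distributed on $\mathbb S$ and independent of $\xi_{t,j}$. For $t\ge0$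 set $$v^{i,t+1}=\Pi_{\mathcal X_i}\Big[v^{i,t}-\zeta\,\frac1{N_t}\sum_{j=0}^{N_t-1}\frac{n_i}{\eta}\Big(\tilde f_i\big((v^{i,t}+\eta s_{t,j},x^{-i}),\xi_{t,j}\big)+\tfrac c2\|v^{i,t}+\eta s_{t,j}-x^i\|^2\Big)s_{t,j}\Big],$$ where $\Pi_{\mathcal X_i}$ is the Euclidean projection onto $\mathcal X_i$. **Lemma (rate statement for the zeroth-order scheme).** Let $\alpha=\tfrac{L_0n_i}{\eta}+c$, $0<\zeta<c/\alpha^2$, $q=1-2c\zeta+2\zeta^2\alpha^2$ (so that $0<q<1$) and $N_t=\lceil q^{-(t+1)}\rceil$. Then there is a constant $C>0$, independent of $t$, of $x$, of $v^{i,0}$ and of the samples, such that for every $t\ge0$ the variable $\|v^{i,t}-v^{i,*}(x)\|^2$ is integrable and $$\mathbb E\big[\|v^{i,t}-v^{i,*}(x)\|^2\mid x\big]\le C\,q^t\quad\text{almost surely.}$$ -/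

import Mathlib

open MeasureTheory ProbabilityTheory Set
open scoped NNReal ENNReal Pointwise

/-- `y` solves the variational inequality `VI(Y, F)`: `y ∈ Y` and `⟨ŷ - y, F y⟩ ≥ 0` for every
`ŷ ∈ Y`. -/
def IsVISolution {m : ℕ} (Y : Set (EuclideanSpace ℝ (Fin m)))
    (F : EuclideanSpace ℝ (Fin m) → EuclideanSpace ℝ (Fin m))
    (y : EuclideanSpace ℝ (Fin m)) : Prop :=
  y ∈ Y ∧ ∀ y' ∈ Y, 0 ≤ inner ℝ (y' - y) (F y)

/-- Euclidean projection onto a set: a point of `S` at minimal distance from `z`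
(it exists and is unique when `S` is nonempty, closed and convex). -/
noncomputable def euclProj {d : ℕ} (S : Set (EuclideanSpace ℝ (Fin d)))
    (z : EuclideanSpace ℝ (Fin d)) : EuclideanSpace ℝ (Fin d) :=
  Classical.epsilon fun p => p ∈ S ∧ ∀ w ∈ S, ‖z - p‖ ≤ ‖z - w‖

/-- The uniform distribution on the unit sphere of `ℝ^d`: normalized surface measure. -/
noncomputable def uniformSphere (d : ℕ) :
    Measure (Metric.sphere (0 : EuclideanSpace ℝ (Fin d)) 1) :=
  ((volume : Measure (EuclideanSpace ℝ (Fin d))).toSphere univ)⁻¹ •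
    (volume : Measure (EuclideanSpace ℝ (Fin d))).toSphere

/-- The data of a stochastic hierarchical game with `N` players. Player `i` has decisions in
`X i ⊆ ℝ^{n i}` and the lower-level problem `VI(Y i, F i (·, x, ξ))` in `ℝ^{m i}`; her sampled
objective is `g i (x, ξ) + h i (x i, y, ξ)`, where `y` is the lower-level solution; the scenario
`ξ` has the distribution `law`. -/
structure HierarchicalGame (N : ℕ) (n m : Fin N → ℕ) (Ξ : Type*) [MeasurableSpace Ξ] where
  X : ∀ i, Set (EuclideanSpace ℝ (Fin (n i)))
  Y : ∀ i, Set (EuclideanSpace ℝ (Fin (m i)))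
  F : ∀ i, EuclideanSpace ℝ (Fin (m i)) → (∀ j, EuclideanSpace ℝ (Fin (n j))) → Ξ →
    EuclideanSpace ℝ (Fin (m i))
  g : ∀ _ : Fin N, (∀ j, EuclideanSpace ℝ (Fin (n j))) → Ξ → ℝ
  h : ∀ i, EuclideanSpace ℝ (Fin (n i)) → EuclideanSpace ℝ (Fin (m i)) → Ξ → ℝ
  law : Measure Ξ
  X_nonempty : ∀ i, (X i).Nonempty
  X_closed : ∀ i, IsClosed (X i)
  X_convex : ∀ i, Convex ℝ (X i)
  Y_closed : ∀ i, IsClosed (Y i)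
  Y_convex : ∀ i, Convex ℝ (Y i)
  law_prob : IsProbabilityMeasure law

namespace HierarchicalGame

variable {N : ℕ} {n m : Fin N → ℕ} {Ξ : Type*} [MeasurableSpace Ξ]
  (G : HierarchicalGame N n m Ξ) (i : Fin N)

/-- The joint strategy set, the product of the sets `X j`. -/
def strategies : Set (∀ j, EuclideanSpace ℝ (Fin (n j))) := {x | ∀ j, x j ∈ G.X j}

/-- The set `X i + η 𝔹`, with `𝔹` the closed unit ball. -/
def enlarged (η : ℝ) : Set (EuclideanSpace ℝ (Fin (n i))) := G.X i + Metric.closedBall 0 η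

/-- The profiles with `x i ∈ X i + η 𝔹` and `x j ∈ X j` for the rivals `j ≠ i`. -/
def domain (η : ℝ) : Set (∀ j, EuclideanSpace ℝ (Fin (n j))) :=
  {x | x i ∈ G.enlarged i η ∧ ∀ j, j ≠ i → x j ∈ G.X j}

/-- The lower-level response `y^i(x, ξ)`: the solution of `VI(Y i, F i (·, x, ξ))`. -/
noncomputable def lower (x : ∀ j, EuclideanSpace ℝ (Fin (n j))) (ξ : Ξ) :
    EuclideanSpace ℝ (Fin (m i)) :=
  Classical.epsilon fun y => IsVISolution (G.Y i) (fun y' => G.F i y' x ξ) y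

/-- The sampled implicit objective `g_i(x, ξ) + h_i(x^i, y^i(x, ξ), ξ)`. -/
noncomputable def sampledObj (x : ∀ j, EuclideanSpace ℝ (Fin (n j))) (ξ : Ξ) : ℝ :=
  G.g i x ξ + G.h i (x i) (G.lower i x ξ) ξ

/-- The implicit objective `f_i(x)`, the expectation of the sampled one. -/
noncomputable def obj (x : ∀ j, EuclideanSpace ℝ (Fin (n j))) : ℝ :=
  ∫ ξ, G.sampledObj i x ξ ∂G.law

/-- The smoothed objective `f_{i,η}(x) = 𝔼[f_i(x^i + η u, x^{-i})]`, with `u` uniformly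
distributed on the closed unit ball. -/
noncomputable def smoothedObj (η : ℝ) (x : ∀ j, EuclideanSpace ℝ (Fin (n j))) : ℝ :=
  ⨍ u in Metric.closedBall (0 : EuclideanSpace ℝ (Fin (n i))) 1,
    G.obj i (Function.update x i (x i + η • u))

/-- The smoothed proximal objective
`φ_{i,η}(v, x) = f_{i,η}(v, x^{-i}) + (c / 2) ‖v - x^i‖²`. -/
noncomputable def proxObj (η c : ℝ) (v : EuclideanSpace ℝ (Fin (n i)))
    (x : ∀ j, EuclideanSpace ℝ (Fin (n j))) : ℝ :=
  G.smoothedObj i η (Function.update x i v) + c / 2 * ‖v - x i‖ ^ 2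

/-- The zeroth-order gradient estimate at `v` built from one scenario `ξ` and one direction `s`
on the unit sphere. -/
noncomputable def sampleGrad (η c : ℝ) (x : ∀ j, EuclideanSpace ℝ (Fin (n j)))
    (v : EuclideanSpace ℝ (Fin (n i))) (ξ : Ξ)
    (s : Metric.sphere (0 : EuclideanSpace ℝ (Fin (n i))) 1) : EuclideanSpace ℝ (Fin (n i)) :=
  (((n i : ℝ) / η) * (G.sampledObj i (Function.update x i (v + η • s.1)) ξ
    + c / 2 * ‖v + η • s.1 - x i‖ ^ 2)) • s.1

/-- The mini-batch zeroth-order gradient estimate: the average over the first `B` samples. -/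
noncomputable def batchGrad (η c : ℝ) (x : ∀ j, EuclideanSpace ℝ (Fin (n j)))
    (v : EuclideanSpace ℝ (Fin (n i))) (B : ℕ) (ξ : ℕ → Ξ)
    (s : ℕ → Metric.sphere (0 : EuclideanSpace ℝ (Fin (n i))) 1) :
    EuclideanSpace ℝ (Fin (n i)) :=
  (B : ℝ)⁻¹ • ∑ j ∈ Finset.range B, G.sampleGrad i η c x v (ξ j) (s j)

/-- The projected zeroth-order scheme for minimizing `φ_{i,η}(·, x)` over `X i`, started at `v₀`,
with constant step `ζ`; step `t` uses the first `B t` of the samples `(ξ t j, s t j)`. -/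
noncomputable def zsol (η c ζ : ℝ) (B : ℕ → ℕ) (x : ∀ j, EuclideanSpace ℝ (Fin (n j)))
    (v₀ : EuclideanSpace ℝ (Fin (n i))) (ξ : ℕ → ℕ → Ξ)
    (s : ℕ → ℕ → Metric.sphere (0 : EuclideanSpace ℝ (Fin (n i))) 1) :
    ℕ → EuclideanSpace ℝ (Fin (n i))
  | 0 => v₀
  | t + 1 => euclProj (G.X i) (zsol η c ζ B x v₀ ξ s t -
      ζ • G.batchGrad i η c x (zsol η c ζ B x v₀ ξ s t) (B t) (ξ t) (s t))

end HierarchicalGame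

/-! For a fixed profile `x` the scheme is projected stochastic gradient descent on the strongly
convex function `φ = proxObj (·, x)`. The rate comes from balancing a deterministic contraction
against a batch variance that shrinks geometrically.

The gradient estimate is unbiased. The directional derivative of a ball average of a continuous
function is a sphere average (`hasDerivAt_setAverage_closedBall`). No differentiability of the
function is needed, since it is the ball that moves, and its boundary is differentiated in polar
coordinates. Hence the mean estimate `meanGrad` is the gradient of `φ` along segments of `X i`
(`hasDerivWithinAt_proxObj`). It is `α`-Lipschitz because the objective is Lipschitz, and
`c`-strongly monotone because `φ` is strongly convex. So a noiseless projected step multiplies the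
squared distance to the minimizer by at most `κ = 1 - 2cζ + ζ²α²`. A single estimate has second
moment at most a constant `K`, uniform on the bounded set `X i`, so averaging `N_t` independent
estimates adds at most `ζ²K / N_t`.

The iterate `v t` depends only on `x`, `v₀` and the batches before `t`, so it may be frozen while
batch `t` is integrated out. On an event `{x ∈ A}` this gives `a_{t+1} ≤ κ a_t + (ζ²K / N_t) P(x ∈
A)` for the integrated squared error `a_t`. Since `q = κ + ζ²α²` exceeds `κ`, and `1 / N_t ≤
q^(t+1)`, the bound `a_t ≤ C q^t P(x ∈ A)` propagates as soon as `C α² ≥ K q`. Letting `A` vary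
turns it into the bound on the conditional expectation.

The minimizer map `vstar` is not assumed measurable. On the strategy set it is the limit of
noiseless projected gradient iterates, which are measurable in `x`
(`measurable_indicator_minimizer`). -/

/-! ### Differentiating an integral over a moving ball. -/

section BallSmoothing

variable {E : Type*} [NormedAddCommGroup E] [InnerProductSpace ℝ E]

/-- The distance from the origin to the boundary of the unit ball centred at `t • e`, in the
direction `s`. -/
noncomputable def shiftedRadius (e s : E) (t : ℝ) : ℝ :=
  t * inner ℝ s e + √(1 - t ^ 2 * (‖e‖ ^ 2 - inner ℝ s e ^ 2))

/-- The origin lies strictly inside the shifted ball, so the quadratic for the exit radius has one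
negative and one positive root; the inequality is `t²‖e‖² < 1` rearranged. -/
theorem shiftedRadius_discr_pos {e s : E} {t : ℝ} (ht : (t * ‖e‖) ^ 2 < 1) :
    (t * inner ℝ s e) ^ 2 < 1 - t ^ 2 * (‖e‖ ^ 2 - inner ℝ s e ^ 2) := by
  nlinarith

/-- Squaring gives a quadratic condition on `r` between two roots. The lower root is negative, so
only the upper one, `shiftedRadius`, constrains a positive `r`. -/
theorem norm_smul_sub_smul_le_one_iff {e s : E} (hs : ‖s‖ = 1) {t r : ℝ}
    (ht : (t * ‖e‖) ^ 2 < 1) (hr : 0 < r) :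
    ‖r • s - t • e‖ ≤ 1 ↔ r ≤ shiftedRadius e s t := by
  have hD := shiftedRadius_discr_pos (s := s) ht
  have hsq : ‖r • s - t • e‖ ^ 2 = r ^ 2 - 2 * (r * (t * inner ℝ s e)) + t ^ 2 * ‖e‖ ^ 2 := by
    rw [norm_sub_sq_real, norm_smul, norm_smul, inner_smul_left, inner_smul_right, hs]
    simp [mul_pow]
  set a : ℝ := inner ℝ s e
  have h1 : t * a < √(1 - t ^ 2 * (‖e‖ ^ 2 - a ^ 2)) := Real.lt_sqrt_of_sq_lt hD
  have h2 : ‖r • s - t • e‖ ≤ 1 ↔ (r - t * a) ^ 2 ≤ 1 - t ^ 2 * (‖e‖ ^ 2 - a ^ 2) := by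
    rw [← sq_le_one_iff₀ (norm_nonneg _), hsq]
    constructor <;> intro h <;> linarith
  rw [h2, shiftedRadius, ← Real.sqrt_le_sqrt_iff ((sq_nonneg _).trans hD.le), Real.sqrt_sq_eq_abs,
    abs_le]
  change _ ↔ r ≤ t * a + √(1 - t ^ 2 * (‖e‖ ^ 2 - a ^ 2))
  constructor
  · rintro ⟨-, h⟩; linarith
  · intro h; constructor <;> linarith

theorem shiftedRadius_pos {e s : E} {t : ℝ} (ht : (t * ‖e‖) ^ 2 < 1) :
    0 < shiftedRadius e s t := by
  have := Real.lt_sqrt_of_sq_lt ((neg_sq (t * inner ℝ s e)).trans_lt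
    (shiftedRadius_discr_pos (s := s) ht))
  unfold shiftedRadius
  linarith

theorem hasDerivAt_shiftedRadius {e s : E} {t : ℝ} (ht : (t * ‖e‖) ^ 2 < 1) :
    HasDerivAt (shiftedRadius e s)
      (inner ℝ s e - t * (‖e‖ ^ 2 - inner ℝ s e ^ 2) /
        √(1 - t ^ 2 * (‖e‖ ^ 2 - inner ℝ s e ^ 2))) t := by
  have hD : 0 < 1 - t ^ 2 * (‖e‖ ^ 2 - inner ℝ s e ^ 2) :=
    (sq_nonneg _).trans_lt (shiftedRadius_discr_pos (s := s) ht)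
  have h1 : HasDerivAt (fun t : ℝ => 1 - t ^ 2 * (‖e‖ ^ 2 - inner ℝ s e ^ 2))
      (-(2 * t * (‖e‖ ^ 2 - inner ℝ s e ^ 2))) t := by
    have := ((hasDerivAt_pow 2 t).mul_const (‖e‖ ^ 2 - inner ℝ s e ^ 2)).const_sub 1
    simpa using this
  have h2 := ((hasDerivAt_id t).mul_const (inner ℝ s e)).add (h1.sqrt hD.ne')
  refine h2.congr_deriv ?_
  have := (Real.sqrt_pos.2 hD).ne'
  field_simp
  ring

variable [FiniteDimensional ℝ E]
  [Nontrivial E] [MeasurableSpace E] [BorelSpace E]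

/-- Integration in polar coordinates. -/
theorem integral_eq_integral_toSphere_integral_Ioi (μ : Measure E) [μ.IsAddHaarMeasure]
    {f : E → ℝ} (hf : Integrable f μ) :
    ∫ x, f x ∂μ = ∫ s, (∫ r in Ioi (0 : ℝ),
      r ^ (Module.finrank ℝ E - 1) * f (r • (s : E))) ∂μ.toSphere := by
  set g : Metric.sphere (0 : E) 1 × Ioi (0 : ℝ) → ℝ := fun p => f (p.2.1 • p.1.1) with hg
  have hcomp : ∀ x : ({0}ᶜ : Set E), g (homeomorphUnitSphereProd E x) = f x.1 := by
    intro x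
    have hx : ‖(x : E)‖ ≠ 0 := norm_ne_zero_iff.2 x.2
    simp [hg, smul_smul, hx]
  have mp := μ.measurePreserving_homeomorphUnitSphereProd
  have emb := (homeomorphUnitSphereProd E).measurableEmbedding
  have hint : Integrable g (μ.toSphere.prod (.volumeIoiPow (Module.finrank ℝ E - 1))) := by
    rw [← mp.integrable_comp_emb emb]
    have : g ∘ homeomorphUnitSphereProd E = f ∘ Subtype.val := funext hcomp
    rw [this, ← integrableOn_iff_comap_subtypeVal (measurableSet_singleton _).compl]
    exact hf.integrableOn
  calc
    ∫ x, f x ∂μ = ∫ x : ({0}ᶜ : Set E), f x.1 ∂(μ.comap (↑)) := by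
      rw [integral_subtype_comap (measurableSet_singleton _).compl f,
        restrict_compl_singleton]
    _ = ∫ p, g p ∂μ.toSphere.prod (.volumeIoiPow (Module.finrank ℝ E - 1)) := by
      rw [← mp.integral_comp emb]
      exact integral_congr_ae (.of_forall fun x => (hcomp x).symm)
    _ = ∫ s, ∫ r, g (s, r) ∂.volumeIoiPow (Module.finrank ℝ E - 1) ∂μ.toSphere :=
      integral_prod _ hint
    _ = _ := by
      refine integral_congr_ae (.of_forall fun s => ?_)
      simp only [Measure.volumeIoiPow, ENNReal.ofReal]
      rw [integral_withDensity_eq_integral_smul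
          (measurable_subtype_coe.pow_const _).real_toNNReal,
        integral_subtype_comap measurableSet_Ioi
          fun a => Real.toNNReal (a ^ (Module.finrank ℝ E - 1)) • f (a • (s : E))]
      refine setIntegral_congr_fun measurableSet_Ioi fun x hx => ?_
      simp only [NNReal.smul_def, Real.coe_toNNReal _ (pow_nonneg (mem_Ioi.1 hx).le _),
        smul_eq_mul]

/-- The integral of a continuous function over a shifted unit ball, in polar coordinates. -/
theorem setIntegral_closedBall_add_smul (μ : Measure E) [μ.IsAddHaarMeasure] {Φ : E → ℝ}
    (hΦ : Continuous Φ) (e : E) {t : ℝ} (ht : (t * ‖e‖) ^ 2 < 1) :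
    ∫ u in Metric.closedBall (0 : E) 1, Φ (u + t • e) ∂μ =
      ∫ s : Metric.sphere (0 : E) 1, (∫ r in (0 : ℝ)..shiftedRadius e s.1 t,
        r ^ (Module.finrank ℝ E - 1) * Φ (r • (s : E))) ∂μ.toSphere := by
  have hint : Integrable ((Metric.closedBall (t • e) 1).indicator Φ) μ :=
    (hΦ.continuousOn.integrableOn_compact (isCompact_closedBall _ _)).integrable_indicator
      Metric.isClosed_closedBall.measurableSet
  calc
    _ = ∫ u, (Metric.closedBall (t • e) 1).indicator Φ (u + t • e) ∂μ := by
      rw [← integral_indicator Metric.isClosed_closedBall.measurableSet]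
      congr 1; ext u
      simp [indicator, dist_eq_norm]
    _ = ∫ u, (Metric.closedBall (t • e) 1).indicator Φ u ∂μ := integral_add_right_eq_self _ _
    _ = _ := by
      rw [integral_eq_integral_toSphere_integral_Ioi μ hint]
      refine integral_congr_ae (.of_forall fun s => ?_)
      simp only
      rw [intervalIntegral.integral_of_le (shiftedRadius_pos ht).le,
        ← integral_indicator measurableSet_Ioi, ← integral_indicator measurableSet_Ioc]
      congr 1; ext r
      by_cases hr : 0 < r
      · have := norm_smul_sub_smul_le_one_iff (s := s.1) (by simp) ht hr
        simp [indicator, dist_eq_norm, hr, this]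
      · simp [indicator, hr]

/-- The directional derivative at the centre of the integral over a unit ball. -/
theorem hasDerivAt_setIntegral_closedBall (μ : Measure E) [μ.IsAddHaarMeasure] {Φ : E → ℝ}
    (hΦ : Continuous Φ) (e : E) :
    HasDerivAt (fun t : ℝ => ∫ u in Metric.closedBall (0 : E) 1, Φ (u + t • e) ∂μ)
      (∫ s : Metric.sphere (0 : E) 1, Φ s * inner ℝ (s : E) e ∂μ.toSphere) 0 := by
  -- For `|t| ≤ δ` the origin stays inside the shifted ball, so the square root in the radius never
  -- vanishes. Compactness of this range of `t` times the sphere then supplies the dominating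
  -- constant `K`.
  obtain ⟨δ, hδ, hδe⟩ : ∃ δ > 0, δ * ‖e‖ < 1 := by
    refine ⟨1 / (‖e‖ + 1), by positivity, ?_⟩
    rw [div_mul_eq_mul_div, one_mul, div_lt_one (by positivity)]
    linarith
  have hsmall : ∀ t ∈ Metric.closedBall (0 : ℝ) δ, (t * ‖e‖) ^ 2 < 1 := by
    intro t ht
    rw [Metric.mem_closedBall, dist_zero_right, Real.norm_eq_abs] at ht
    rw [sq_lt_one_iff_abs_lt_one, abs_mul, abs_norm]
    exact (mul_le_mul_of_nonneg_right ht (norm_nonneg _)).trans_lt hδe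
  set k := Module.finrank ℝ E - 1
  set H : ℝ → Metric.sphere (0 : E) 1 → ℝ := fun t s =>
    ∫ r in (0 : ℝ)..shiftedRadius e s.1 t, r ^ k * Φ (r • (s : E)) with hH
  set H' : ℝ → Metric.sphere (0 : E) 1 → ℝ := fun t s =>
    shiftedRadius e s.1 t ^ k * Φ (shiftedRadius e s.1 t • (s : E)) *
      (inner ℝ s.1 e - t * (‖e‖ ^ 2 - inner ℝ s.1 e ^ 2) /
        √(1 - t ^ 2 * (‖e‖ ^ 2 - inner ℝ s.1 e ^ 2))) with hH'
  have hrad : Continuous fun p : ℝ × Metric.sphere (0 : E) 1 => shiftedRadius e p.2.1 p.1 := by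
    unfold shiftedRadius; fun_prop
  have hdiff : ∀ t ∈ Metric.closedBall (0 : ℝ) δ, ∀ s, HasDerivAt (H · s) (H' t s) t := by
    intro t ht s
    have hc : Continuous fun r : ℝ => r ^ k * Φ (r • (s : E)) := by fun_prop
    exact (intervalIntegral.integral_hasDerivAt_right (hc.intervalIntegrable _ _)
      hc.aestronglyMeasurable.stronglyMeasurableAtFilter hc.continuousAt).comp t
        (hasDerivAt_shiftedRadius (hsmall t ht))
  have hHcont : ∀ t, Continuous (H t) := fun t =>
    intervalIntegral.continuous_parametric_intervalIntegral_of_continuous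
      (f := fun (s : Metric.sphere (0 : E) 1) (r : ℝ) => r ^ k * Φ (r • (s : E)))
      (by fun_prop) (hrad.comp (by fun_prop : Continuous fun s => (t, s)))
  have hH'cont : ContinuousOn (fun p : ℝ × Metric.sphere (0 : E) 1 => H' p.1 p.2)
      (Metric.closedBall 0 δ ×ˢ univ) := by
    have hden : ∀ p ∈ (Metric.closedBall (0 : ℝ) δ ×ˢ univ :
        Set (ℝ × Metric.sphere (0 : E) 1)),
        √(1 - p.1 ^ 2 * (‖e‖ ^ 2 - inner ℝ p.2.1 e ^ 2)) ≠ 0 := fun p hp =>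
      (Real.sqrt_pos.2 ((sq_nonneg _).trans_lt
        (shiftedRadius_discr_pos (s := p.2.1) (hsmall p.1 hp.1)))).ne'
    refine ContinuousOn.mul (by fun_prop) (ContinuousOn.sub (by fun_prop)
      (ContinuousOn.div (by fun_prop) (by fun_prop) hden))
  have : CompactSpace (Metric.sphere (0 : E) 1) :=
    isCompact_iff_compactSpace.1 (isCompact_sphere _ _)
  obtain ⟨K, hK⟩ := ((isCompact_closedBall (0 : ℝ) δ).prod isCompact_univ).exists_bound_of_continuousOn
    hH'cont
  have key := (hasDerivAt_integral_of_dominated_loc_of_deriv_le (μ := μ.toSphere) (F := H)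
    (F' := H') (bound := fun _ => K) (Metric.closedBall_mem_nhds (0 : ℝ) hδ)
    (.of_forall fun t => (hHcont t).aestronglyMeasurable)
    ((integrableOn_univ (μ := μ.toSphere)).1
      ((hHcont 0).continuousOn.integrableOn_compact isCompact_univ))
    (by
      have : Continuous (H' 0) := by
        rw [← continuousOn_univ]
        exact hH'cont.comp (f := fun s => ((0 : ℝ), s)) (by fun_prop)
          fun s _ => ⟨Metric.mem_closedBall_self hδ.le, mem_univ _⟩
      exact this.aestronglyMeasurable)
    (.of_forall fun s t ht => hK (t, s) ⟨ht, mem_univ _⟩) (integrable_const _)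
    (.of_forall fun s t ht => hdiff t ht s)).2
  -- At `t = 0` the radius is `1` and its derivative is `⟪s, e⟫`.
  have hfin : ∀ s : Metric.sphere (0 : E) 1, H' 0 s = Φ s * inner ℝ (s : E) e := by
    intro s; simp [hH', shiftedRadius]
  simp only [hfin] at key
  refine key.congr_of_eventuallyEq ?_
  filter_upwards [Metric.closedBall_mem_nhds (0 : ℝ) hδ] with t ht
  exact setIntegral_closedBall_add_smul μ hΦ e (hsmall t ht)

end BallSmoothing

theorem isProbabilityMeasure_uniformSphere {d : ℕ} (hd : 0 < d) :
    IsProbabilityMeasure (uniformSphere d) := by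
  have : Nonempty (Fin d) := ⟨⟨0, hd⟩⟩
  constructor
  rw [uniformSphere, Measure.smul_apply, smul_eq_mul]
  exact ENNReal.inv_mul_cancel (by simp [hd.ne', (Metric.measure_ball_pos volume _ one_pos).ne'])
    (measure_ne_top _ _)

/-- The directional derivative of a ball average is a sphere average. -/
theorem hasDerivAt_setAverage_closedBall {d : ℕ} (hd : 0 < d)
    {f : EuclideanSpace ℝ (Fin d) → ℝ} (hf : Continuous f) {η : ℝ} (hη : 0 < η)
    (v w : EuclideanSpace ℝ (Fin d)) :
    HasDerivAt (fun t : ℝ => ⨍ u in Metric.closedBall (0 : EuclideanSpace ℝ (Fin d)) 1,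
        f (v + t • w + η • u))
      (∫ s, d / η * f (v + η • s.1) * inner ℝ s.1 w ∂uniformSphere d) 0 := by
  have : Nonempty (Fin d) := ⟨⟨0, hd⟩⟩
  -- Moving the centre by `t • w` at scale `η` shifts the unit ball by `t • η⁻¹ • w`, whence the
  -- factor `1 / η`. The factor `d` is the ratio of the sphere's total mass to the ball's volume.
  have h := hasDerivAt_setIntegral_closedBall (volume : Measure (EuclideanSpace ℝ (Fin d)))
    (Φ := fun u => f (v + η • u)) (by fun_prop) (η⁻¹ • w)
  have hpos : 0 < (volume : Measure (EuclideanSpace ℝ (Fin d))).real (Metric.ball 0 1) :=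
    ENNReal.toReal_pos (Metric.isOpen_ball.measure_ne_zero _ (by simp)) measure_ball_lt_top.ne
  refine ((h.const_mul (volume.real
    (Metric.closedBall (0 : EuclideanSpace ℝ (Fin d)) 1))⁻¹).congr_deriv ?_).congr_of_eventuallyEq
    (.of_forall fun t => ?_)
  · rw [uniformSphere, integral_smul_measure, ENNReal.toReal_inv, ← measureReal_def,
      Measure.toSphere_real_apply_univ, measureReal_def, Measure.addHaar_closedBall_eq_addHaar_ball,
      ← measureReal_def]
    simp only [inner_smul_right, finrank_euclideanSpace_fin, smul_eq_mul]
    rw [← integral_const_mul, ← integral_const_mul]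
    congr 1; ext s
    have : (d : ℝ) ≠ 0 := by positivity
    field_simp
  · simp only [setAverage_eq, smul_eq_mul]
    congr 2; ext u
    congr 1
    rw [smul_add, smul_smul, smul_smul, show η * t * η⁻¹ = t by field_simp]
    abel

/-! ### Euclidean projection and its variational inequality. -/

section Projection

variable {d : ℕ} {S : Set (EuclideanSpace ℝ (Fin d))}

theorem euclProj_mem_and_inner_le (hne : S.Nonempty) (hcl : IsClosed S) (hcv : Convex ℝ S)
    (z : EuclideanSpace ℝ (Fin d)) :
    euclProj S z ∈ S ∧ ∀ w ∈ S, inner ℝ (z - euclProj S z) (w - euclProj S z) ≤ 0 := by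
  have bdd : BddBelow (range fun w : S => ‖z - w‖) :=
    ⟨0, by rintro _ ⟨w, rfl⟩; exact norm_nonneg _⟩
  have : Nonempty S := hne.to_subtype
  obtain ⟨p, hp, hmin⟩ := exists_norm_eq_iInf_of_complete_convex hne hcl.isComplete hcv z
  have hex : ∃ p, p ∈ S ∧ ∀ w ∈ S, ‖z - p‖ ≤ ‖z - w‖ :=
    ⟨p, hp, fun w hw => hmin ▸ ciInf_le bdd ⟨w, hw⟩⟩
  obtain ⟨hmem, hle⟩ := Classical.epsilon_spec hex
  change euclProj S z ∈ S at hmem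
  change ∀ w ∈ S, ‖z - euclProj S z‖ ≤ ‖z - w‖ at hle
  refine ⟨hmem, (norm_eq_iInf_iff_real_inner_le_zero hcv hmem).1 ?_⟩
  exact le_antisymm (le_ciInf fun w => hle w w.2) (ciInf_le bdd ⟨_, hmem⟩)

theorem euclProj_mem (hne : S.Nonempty) (hcl : IsClosed S) (hcv : Convex ℝ S)
    (z : EuclideanSpace ℝ (Fin d)) : euclProj S z ∈ S :=
  (euclProj_mem_and_inner_le hne hcl hcv z).1

/-- Nonexpansiveness of the projection, with `p` known only through the variational inequality that
makes it the projection of `z'`. This is the form in which a minimizer enters. -/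
theorem norm_euclProj_sub_le (hne : S.Nonempty) (hcl : IsClosed S) (hcv : Convex ℝ S)
    (z : EuclideanSpace ℝ (Fin d)) {p z' : EuclideanSpace ℝ (Fin d)} (hp : p ∈ S)
    (hvi : ∀ w ∈ S, inner ℝ (z' - p) (w - p) ≤ 0) : ‖euclProj S z - p‖ ≤ ‖z - z'‖ := by
  obtain ⟨hmem, hle⟩ := euclProj_mem_and_inner_le hne hcl hcv z
  set P := euclProj S z
  have h1 := hle p hp
  have h2 := hvi P hmem
  -- Sum of the two variational inequalities, each tested at the other point.
  have h3 : ‖P - p‖ ^ 2 ≤ inner ℝ (z - z') (P - p) := by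
    rw [← real_inner_self_eq_norm_sq]
    have e1 : inner ℝ (z - P) (p - P) = - inner ℝ (z - P) (P - p) := by
      rw [← inner_neg_right, neg_sub]
    have e2 : inner ℝ (z - z') (P - p)
        = inner ℝ (z - P) (P - p) + inner ℝ (P - p) (P - p) - inner ℝ (z' - p) (P - p) := by
      rw [← inner_add_left, ← inner_sub_left]; congr 1; abel
    linarith
  have h4 := real_inner_le_norm (z - z') (P - p)
  by_contra! hlt
  have : 0 < ‖P - p‖ := (norm_nonneg _).trans_lt hlt
  nlinarith

theorem continuous_euclProj (hne : S.Nonempty) (hcl : IsClosed S) (hcv : Convex ℝ S) :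
    Continuous (euclProj S) := by
  refine (LipschitzWith.of_dist_le_mul (K := 1) fun z z' => ?_).continuous
  have h := euclProj_mem_and_inner_le hne hcl hcv z'
  simpa [dist_eq_norm] using norm_euclProj_sub_le hne hcl hcv z h.1 h.2

end Projection

/-! ### First-order consequences of strong convexity. -/

section StrongConvexity

variable {E : Type*} [NormedAddCommGroup E] [InnerProductSpace ℝ E] {S : Set E} {φ : E → ℝ}
  {v w a : E} {c : ℝ}

/-- Divide the strong convexity inequality on the segment by `t` and let `t → 0+`. A one-sided
derivative suffices, so `v` may be a boundary point. -/
theorem StrongConvexOn.add_inner_add_le (hφ : StrongConvexOn S c φ) (hv : v ∈ S) (hw : w ∈ S)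
    (hd : HasDerivWithinAt (fun t : ℝ => φ (v + t • (w - v))) (inner ℝ a (w - v)) (Icc 0 1) 0) :
    φ v + inner ℝ a (w - v) + c / 2 * ‖w - v‖ ^ 2 ≤ φ w := by
  have hs := (hasDerivWithinAt_iff_tendsto_slope' (s := Ioo (0 : ℝ) 1) (by simp)).1
    (hd.mono Ioo_subset_Icc_self)
  have := left_nhdsWithin_Ioo_neBot (zero_lt_one' ℝ)
  have hlim : Filter.Tendsto (fun t : ℝ => φ w - φ v - (1 - t) * (c / 2 * ‖w - v‖ ^ 2))
      (nhdsWithin 0 (Ioo 0 1)) (nhds (φ w - φ v - (1 - 0) * (c / 2 * ‖w - v‖ ^ 2))) :=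
    tendsto_nhdsWithin_of_tendsto_nhds (Continuous.tendsto (by fun_prop) 0)
  have hle := le_of_tendsto_of_tendsto hs hlim (by
    filter_upwards [self_mem_nhdsWithin] with t ht
    have h := hφ.2 hv hw (sub_nonneg.2 ht.2.le) ht.1.le (sub_add_cancel 1 t)
    have e : (1 - t) • v + t • w = v + t • (w - v) := by module
    rw [e, norm_sub_rev v w] at h
    simp only [slope_def_field, sub_zero, zero_smul, add_zero]
    rw [div_le_iff₀ ht.1]
    simp only [smul_eq_mul] at h
    linarith)
  linarith

theorem inner_sub_nonneg_of_isMinOn (hS : Convex ℝ S) (hφ : IsMinOn φ S v) (hv : v ∈ S)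
    (hw : w ∈ S)
    (hd : HasDerivWithinAt (fun t : ℝ => φ (v + t • (w - v))) (inner ℝ a (w - v)) (Icc 0 1) 0) :
    0 ≤ inner ℝ a (w - v) := by
  have hs := (hasDerivWithinAt_iff_tendsto_slope' (s := Ioo (0 : ℝ) 1) (by simp)).1
    (hd.mono Ioo_subset_Icc_self)
  have := left_nhdsWithin_Ioo_neBot (zero_lt_one' ℝ)
  refine ge_of_tendsto hs ?_
  filter_upwards [self_mem_nhdsWithin] with t ht
  simp only [slope_def_field, sub_zero, zero_smul, add_zero]
  exact div_nonneg (sub_nonneg.2 (hφ (hS.add_smul_sub_mem hv hw (Ioo_subset_Icc_self ht))))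
    ht.1.le

/-- Expand the square: strong monotonicity bounds the cross term and the Lipschitz bound controls
the quadratic one. -/
theorem norm_sub_sub_smul_sq_le {a b : E} {α ζ : ℝ} (hζ : 0 ≤ ζ)
    (hmono : c * ‖v - w‖ ^ 2 ≤ inner ℝ (a - b) (v - w)) (hlip : ‖a - b‖ ≤ α * ‖v - w‖) :
    ‖v - w - ζ • (a - b)‖ ^ 2 ≤ (1 - 2 * c * ζ + ζ ^ 2 * α ^ 2) * ‖v - w‖ ^ 2 := by
  rw [norm_sub_sq_real, norm_smul, inner_smul_right, real_inner_comm, mul_pow, Real.norm_eq_abs,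
    sq_abs]
  have h := mul_le_mul_of_nonneg_left hmono hζ
  have h2 : ‖a - b‖ ^ 2 ≤ (α * ‖v - w‖) ^ 2 := by gcongr
  nlinarith [mul_le_mul_of_nonneg_left h2 (sq_nonneg ζ)]

end StrongConvexity

/-! ### Mini-batch variance, independence and conditional bounds. -/

section Probability

variable {Ω : Type*} [MeasurableSpace Ω] {μ : Measure Ω} [IsProbabilityMeasure μ]

section MiniBatch

variable {E : Type*} [NormedAddCommGroup E] [InnerProductSpace ℝ E] [CompleteSpace E]

theorem integral_norm_sub_mean_sq_le {Y : Ω → E} (hY : MemLp Y 2 μ) :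
    ∫ ω, ‖Y ω - ∫ ω', Y ω' ∂μ‖ ^ 2 ∂μ ≤ ∫ ω, ‖Y ω‖ ^ 2 ∂μ := by
  set g := ∫ ω', Y ω' ∂μ
  have hi := hY.integrable one_le_two
  have h2 := hY.integrable_norm_pow two_ne_zero
  have e : ∀ ω, ‖Y ω - g‖ ^ 2 = ‖Y ω‖ ^ 2 - 2 * inner ℝ g (Y ω) + ‖g‖ ^ 2 := fun ω => by
    rw [norm_sub_sq_real, real_inner_comm]
  have hin : Integrable (fun ω => inner ℝ g (Y ω)) μ := hi.const_inner g
  simp_rw [e]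
  rw [integral_add (by exact h2.sub (hin.const_mul 2)) (integrable_const _),
    integral_sub h2 (hin.const_mul 2), integral_const_mul, integral_inner hi,
    real_inner_self_eq_norm_sq]
  simp only [integral_const, probReal_univ, one_smul]
  linarith [sq_nonneg ‖g‖]

variable [MeasurableSpace E] [BorelSpace E]

/-- Cross terms vanish by pairwise independence and zero mean. -/
theorem integral_norm_sum_sq_eq {Z : ℕ → Ω → E} (hZ : ∀ j, MemLp (Z j) 2 μ)
    (hmean : ∀ j, ∫ ω, Z j ω ∂μ = 0) (hind : Pairwise fun j k => IndepFun (Z j) (Z k) μ) (B : ℕ) :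
    ∫ ω, ‖∑ j ∈ Finset.range B, Z j ω‖ ^ 2 ∂μ = ∑ j ∈ Finset.range B, ∫ ω, ‖Z j ω‖ ^ 2 ∂μ := by
  have hint : ∀ j k, Integrable (fun ω => inner ℝ (Z j ω) (Z k ω)) μ := fun j k => by
    refine Integrable.mono' (((hZ j).integrable_norm_pow two_ne_zero).add
      ((hZ k).integrable_norm_pow two_ne_zero)) ((hZ j).1.inner (hZ k).1) (.of_forall fun ω => ?_)
    refine (norm_inner_le_norm _ _).trans ?_
    simp only [Pi.add_apply]
    nlinarith [sq_nonneg (‖Z j ω‖ - ‖Z k ω‖), sq_nonneg (‖Z j ω‖ + ‖Z k ω‖)]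
  simp_rw [← real_inner_self_eq_norm_sq, sum_inner, inner_sum]
  rw [integral_finsetSum _ fun j _ => integrable_finsetSum _ fun k _ => hint j k]
  refine Finset.sum_congr rfl fun j hj => ?_
  rw [integral_finsetSum _ fun k _ => hint j k]
  refine Finset.sum_eq_single_of_mem j hj fun k _ hkj => ?_
  have : ∫ ω, inner ℝ (Z j ω) (Z k ω) ∂μ = inner ℝ (∫ ω, Z j ω ∂μ) (∫ ω, Z k ω ∂μ) :=
    (hind hkj.symm).integral_bilin ((hZ j).integrable one_le_two)
      ((hZ k).integrable one_le_two) (innerSL ℝ)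
  rw [this, hmean, inner_zero_left]

/-- The second moment after a step along a mini-batch average of independent vectors. -/
theorem integral_norm_sub_smul_average_sq_le {Y : ℕ → Ω → E} {g : E} {K : ℝ}
    (hY : ∀ j, MemLp (Y j) 2 μ) (hmean : ∀ j, ∫ ω, Y j ω ∂μ = g)
    (hK : ∀ j, ∫ ω, ‖Y j ω‖ ^ 2 ∂μ ≤ K)
    (hind : Pairwise fun j k => IndepFun (Y j) (Y k) μ) {B : ℕ} (hB : 0 < B) (a : E) (ζ : ℝ) :
    ∫ ω, ‖a - ζ • ((B : ℝ)⁻¹ • ∑ j ∈ Finset.range B, Y j ω)‖ ^ 2 ∂μ ≤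
      ‖a - ζ • g‖ ^ 2 + ζ ^ 2 * K / B := by
  have hB' : (0 : ℝ) < B := by exact_mod_cast hB
  set Z : ℕ → Ω → E := fun j ω => Y j ω - g with hZdef
  have hZ : ∀ j, MemLp (Z j) 2 μ := fun j => (hY j).sub (memLp_const g)
  have hZmean : ∀ j, ∫ ω, Z j ω ∂μ = 0 := fun j => by
    rw [integral_sub ((hY j).integrable one_le_two) (integrable_const _), hmean]; simp
  have hZind : Pairwise fun j k => IndepFun (Z j) (Z k) μ := fun j k hjk =>
    (hind hjk).comp (φ := fun y => y - g) (ψ := fun y => y - g) (by fun_prop) (by fun_prop)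
  have hSL : MemLp (fun ω => ∑ j ∈ Finset.range B, Z j ω) 2 μ :=
    memLp_finsetSum _ fun j _ => hZ j
  have hS2 := hSL.integrable_norm_pow two_ne_zero
  have hS1 := hSL.integrable one_le_two
  have hin : Integrable (fun ω => inner ℝ (a - ζ • g) (∑ j ∈ Finset.range B, Z j ω)) μ :=
    hS1.const_inner _
  -- Separate the mean step from the centred fluctuation: the cross term has mean zero, and the last
  -- term is a variance of order `ζ²K / B`.
  have e : ∀ ω, ‖a - ζ • ((B : ℝ)⁻¹ • ∑ j ∈ Finset.range B, Y j ω)‖ ^ 2 =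
      ‖a - ζ • g‖ ^ 2 - 2 * (ζ / B) * inner ℝ (a - ζ • g) (∑ j ∈ Finset.range B, Z j ω) +
        (ζ / B) ^ 2 * ‖∑ j ∈ Finset.range B, Z j ω‖ ^ 2 := fun ω => by
    have : a - ζ • ((B : ℝ)⁻¹ • ∑ j ∈ Finset.range B, Y j ω) =
        (a - ζ • g) - (ζ / B) • ∑ j ∈ Finset.range B, Z j ω := by
      simp only [hZdef, Finset.sum_sub_distrib, Finset.sum_const, Finset.card_range,
        ← Nat.cast_smul_eq_nsmul ℝ, smul_sub, smul_smul]
      rw [div_mul_cancel₀ _ hB'.ne', div_eq_mul_inv]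
      abel
    rw [this, norm_sub_sq_real, norm_smul, inner_smul_right, mul_pow, Real.norm_eq_abs, sq_abs]
    ring
  simp_rw [e]
  rw [integral_add (by exact (integrable_const _).sub (hin.const_mul _)) (hS2.const_mul _),
    integral_sub (integrable_const _) (hin.const_mul _), integral_const_mul, integral_const_mul,
    integral_inner hS1, integral_finsetSum _ fun j _ => (hZ j).integrable one_le_two,
    integral_norm_sum_sq_eq hZ hZmean hZind]
  simp only [hZmean, Finset.sum_const_zero, inner_zero_right, mul_zero, sub_zero, integral_const,
    probReal_univ, one_smul]
  have hle : ∑ j ∈ Finset.range B, ∫ ω, ‖Z j ω‖ ^ 2 ∂μ ≤ B * K := by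
    refine (Finset.sum_le_card_nsmul _ _ K fun j _ => ?_).trans_eq (by simp)
    have := integral_norm_sub_mean_sq_le (hY j)
    rw [hmean] at this
    exact this.trans (hK j)
  have := mul_le_mul_of_nonneg_left hle (sq_nonneg (ζ / B))
  have e2 : (ζ / B) ^ 2 * (B * K) = ζ ^ 2 * K / B := by field_simp
  linarith

end MiniBatch

/-- If `(g, h)` is independent of `f`, and `g` of `h`, then `(f, g)` is independent of `h`. -/
theorem ProbabilityTheory.IndepFun.prodMk_left_of_prodMk_right {α β γ : Type*} [MeasurableSpace α]
    [MeasurableSpace β] [MeasurableSpace γ] {f : Ω → α} {g : Ω → β} {h : Ω → γ}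
    (hf : Measurable f) (hg : Measurable g) (hh : Measurable h)
    (h1 : IndepFun f (fun ω => (g ω, h ω)) μ) (h2 : IndepFun g h μ) :
    IndepFun (fun ω => (f ω, g ω)) h μ := by
  have := Measure.isProbabilityMeasure_map (μ := μ) hf.aemeasurable
  have := Measure.isProbabilityMeasure_map (μ := μ) hg.aemeasurable
  have := Measure.isProbabilityMeasure_map (μ := μ) hh.aemeasurable
  have h3 : IndepFun f g μ := h1.comp (φ := id) (ψ := Prod.fst) measurable_id measurable_fst
  rw [indepFun_iff_map_prod_eq_prod_map_map (by fun_prop) (by fun_prop)] at h1 h2 h3 ⊢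
  rw [h3, ← (measurePreserving_prodAssoc _ _ _).symm.map_eq, ← h2, ← h1,
    Measure.map_map (by fun_prop) (by fun_prop)]
  rfl

/-- For an independent family that is independent of `f`, the vector `f` together with the
members in `S` is independent of the members in a disjoint set `T`. -/
theorem indepFun_prodMk_restrict {ι α β : Type*} [MeasurableSpace α] [MeasurableSpace β]
    {f : Ω → α} {W : ι → Ω → β} (hf : Measurable f) (hW : ∀ p, Measurable (W p))
    (hind : iIndepFun W μ) (hfW : IndepFun f (fun ω p => W p ω) μ) {S T : Set ι}
    (hST : Disjoint S T) :
    IndepFun (fun ω => (f ω, fun p : S => W p ω)) (fun ω (p : T) => W p ω) μ := by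
  refine IndepFun.prodMk_left_of_prodMk_right hf (by fun_prop) (by fun_prop) ?_ ?_
  · exact hfW.comp (φ := id) (ψ := fun w => (fun p : S => w p, fun p : T => w p)) measurable_id
      (by fun_prop)
  -- The restriction of the family to an index set generates the supremum of the σ-algebras of its
  -- members.
  · have key := indep_iSup_of_disjoint (fun p => (hW p).comap_le) hind hST
    have hcomap : ∀ R : Set ι, MeasurableSpace.comap (fun ω (p : R) => W p ω) inferInstance =
        ⨆ p ∈ R, MeasurableSpace.comap (W p) inferInstance := fun R => by
      rw [MeasurableSpace.pi, MeasurableSpace.comap_iSup, iSup_subtype']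
      refine iSup_congr fun p => ?_
      rw [MeasurableSpace.comap_comp]
      rfl
    rw [IndepFun_iff_Indep, hcomap, hcomap]
    exact key

/-- Fubini for the product law: `f` may be frozen while `g` is averaged. It is used with `(x, v t)`
frozen and batch `t` averaged. -/
theorem ProbabilityTheory.IndepFun.integral_eq_integral_integral {α β : Type*} [MeasurableSpace α]
    [MeasurableSpace β] {f : Ω → α} {g : Ω → β} (hf : Measurable f) (hg : Measurable g)
    (h : IndepFun f g μ) {Φ : α × β → ℝ} (hΦ : Measurable Φ)
    (hint : Integrable (fun ω => Φ (f ω, g ω)) μ) :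
    ∫ ω, Φ (f ω, g ω) ∂μ = ∫ ω, ∫ ω', Φ (f ω, g ω') ∂μ ∂μ ∧
      Integrable (fun ω => ∫ ω', Φ (f ω, g ω') ∂μ) μ := by
  have := Measure.isProbabilityMeasure_map (μ := μ) hf.aemeasurable
  have := Measure.isProbabilityMeasure_map (μ := μ) hg.aemeasurable
  have hmap := (indepFun_iff_map_prod_eq_prod_map_map hf.aemeasurable hg.aemeasurable).1 h
  have hpm : AEMeasurable (fun ω => (f ω, g ω)) μ := (hf.prodMk hg).aemeasurable
  have hint' : Integrable Φ ((μ.map f).prod (μ.map g)) := by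
    rw [← hmap, integrable_map_measure hΦ.aestronglyMeasurable hpm]
    exact hint
  have hinner : ∀ a, ∫ b, Φ (a, b) ∂μ.map g = ∫ ω', Φ (a, g ω') ∂μ := fun a =>
    integral_map hg.aemeasurable (hΦ.comp measurable_prodMk_left).aestronglyMeasurable
  have hsm : StronglyMeasurable fun a => ∫ b, Φ (a, b) ∂μ.map g :=
    hΦ.stronglyMeasurable.integral_prod_right'
  constructor
  · rw [← integral_map (f := Φ) hpm hΦ.aestronglyMeasurable, hmap, integral_prod _ hint',
      integral_map hf.aemeasurable hsm.aestronglyMeasurable]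
    simp_rw [hinner]
  · have := (integrable_map_measure hsm.aestronglyMeasurable hf.aemeasurable).1
      hint'.integral_prod_left
    simpa only [Function.comp_def, hinner] using this

end Probability

/-- A conditional expectation is bounded by a constant if its integrals over the conditioning
sets are. -/
theorem condExp_le_const_of_forall_setIntegral_le {Ω : Type*} {m m₀ : MeasurableSpace Ω} {ν : Measure[m₀] Ω}
    [IsFiniteMeasure ν] (hm : m ≤ m₀) {h : Ω → ℝ} (hint : Integrable h ν) {C : ℝ}
    (hle : ∀ s, MeasurableSet[m] s → ∫ ω in s, h ω ∂ν ≤ C * ν.real s) :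
    ∀ᵐ ω ∂ν, (ν[h | m]) ω ≤ C := by
  refine ae_of_ae_trim hm (ae_le_of_forall_setIntegral_le (g := fun _ => C)
    (integrable_condExp.trim hm stronglyMeasurable_condExp) (integrable_const _) fun s hs _ => ?_)
  rw [← setIntegral_trim hm stronglyMeasurable_condExp hs, setIntegral_condExp hm hint hs,
    setIntegral_const, smul_eq_mul, mul_comm, measureReal_def, trim_measurableSet_eq hm hs]
  exact hle s hs

/-! ### Sphere averages of quadratic and of Lipschitz functions. -/

section SphereAverages

variable {d : ℕ}

/-- The cross term is odd in `u`, so smoothing adds only a constant to a quadratic and leaves its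
gradient unchanged. -/
theorem setAverage_closedBall_norm_add_smul_sq (a : EuclideanSpace ℝ (Fin d)) (η : ℝ) :
    ⨍ u in Metric.closedBall (0 : EuclideanSpace ℝ (Fin d)) 1, ‖a + η • u‖ ^ 2 =
      ‖a‖ ^ 2 + η ^ 2 *
        ⨍ u in Metric.closedBall (0 : EuclideanSpace ℝ (Fin d)) 1, ‖u‖ ^ 2 := by
  have hodd : ∫ u in Metric.closedBall (0 : EuclideanSpace ℝ (Fin d)) 1, inner ℝ a u = 0 := by
    rw [← integral_indicator Metric.isClosed_closedBall.measurableSet]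
    have h := integral_neg_eq_self
      ((Metric.closedBall (0 : EuclideanSpace ℝ (Fin d)) 1).indicator fun u => inner ℝ a u) volume
    have e : ∀ u, (Metric.closedBall (0 : EuclideanSpace ℝ (Fin d)) 1).indicator
        (fun u => inner ℝ a u) (-u) =
        -(Metric.closedBall (0 : EuclideanSpace ℝ (Fin d)) 1).indicator
          (fun u => inner ℝ a u) u := fun u => by
      by_cases hu : ‖u‖ ≤ 1 <;> simp [indicator, hu]
    simp_rw [e, integral_neg] at h
    linarith
  have hint : ∀ f : EuclideanSpace ℝ (Fin d) → ℝ, Continuous f →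
      Integrable f (volume.restrict (Metric.closedBall 0 1)) := fun f hf =>
    hf.continuousOn.integrableOn_compact (isCompact_closedBall _ _)
  have hpos : 0 < (volume : Measure (EuclideanSpace ℝ (Fin d))).real (Metric.closedBall 0 1) :=
    ENNReal.toReal_pos (Metric.measure_closedBall_pos _ _ one_pos).ne'
      measure_closedBall_lt_top.ne
  have e : ∀ u : EuclideanSpace ℝ (Fin d),
      ‖a + η • u‖ ^ 2 = ‖a‖ ^ 2 + 2 * η * inner ℝ a u + η ^ 2 * ‖u‖ ^ 2 := fun u => by
    rw [norm_add_sq_real, norm_smul, inner_smul_right, mul_pow, Real.norm_eq_abs, sq_abs]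
    ring
  simp_rw [setAverage_eq, e]
  rw [integral_add (hint _ (by fun_prop)) (hint _ (by fun_prop)),
    integral_add (hint _ (by fun_prop)) (hint _ (by fun_prop)), integral_const_mul,
    integral_const_mul, hodd, setIntegral_const]
  simp only [smul_eq_mul]
  field_simp
  ring

theorem integrable_uniformSphere (hd : 0 < d) {F : Type*} [NormedAddCommGroup F]
    [SecondCountableTopology F] {f : Metric.sphere (0 : EuclideanSpace ℝ (Fin d)) 1 → F}
    (hf : Continuous f) :
    Integrable f (uniformSphere d) := by
  have := isProbabilityMeasure_uniformSphere hd
  have : CompactSpace (Metric.sphere (0 : EuclideanSpace ℝ (Fin d)) 1) :=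
    isCompact_iff_compactSpace.1 (isCompact_sphere _ _)
  obtain ⟨K, hK⟩ := isCompact_univ.exists_bound_of_continuousOn hf.continuousOn
  exact Integrable.of_bound hf.aestronglyMeasurable K (.of_forall fun s => hK s (mem_univ _))

/-- The sphere-averaged gradient estimate is exact for a quadratic. -/
theorem integral_uniformSphere_quadratic_smul (hd : 0 < d) {η : ℝ} (hη : 0 < η) (c : ℝ)
    (v y : EuclideanSpace ℝ (Fin d)) :
    ∫ s, (d / η * (c / 2 * ‖v + η • s.1 - y‖ ^ 2)) • s.1 ∂uniformSphere d = c • (v - y) := by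
  refine ext_inner_right ℝ fun w => ?_
  rw [real_inner_comm, ← integral_inner (integrable_uniformSphere hd (by fun_prop))]
  -- The same ball average is differentiated twice: by the sphere formula and explicitly. Uniqueness
  -- of the derivative identifies the results.
  have h1 := hasDerivAt_setAverage_closedBall hd (f := fun z => ‖z - y‖ ^ 2) (by fun_prop) hη v w
  have h2 : HasDerivAt (fun t : ℝ => ‖v - y + t • w‖ ^ 2 + η ^ 2 *
      ⨍ u in Metric.closedBall (0 : EuclideanSpace ℝ (Fin d)) 1, ‖u‖ ^ 2)
      (2 * inner ℝ (v - y) w) 0 := by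
    have : HasDerivAt (fun t : ℝ => v - y + t • w) w 0 := by
      simpa using ((hasDerivAt_id (0 : ℝ)).smul_const w).const_add (v - y)
    simpa using this.norm_sq.add_const (η ^ 2 *
      ⨍ u in Metric.closedBall (0 : EuclideanSpace ℝ (Fin d)) 1, ‖u‖ ^ 2)
  have e : ∀ (t : ℝ) (u : EuclideanSpace ℝ (Fin d)),
      v + t • w + η • u - y = v - y + t • w + η • u := fun t u => by abel
  simp_rw [e, setAverage_closedBall_norm_add_smul_sq] at h1
  have h3 := h1.unique h2
  rw [inner_smul_left]
  simp only [conj_trivial]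
  calc _ = c / 2 * ∫ s, d / η * ‖v + η • s.1 - y‖ ^ 2 * inner ℝ s.1 w ∂uniformSphere d := by
        rw [← integral_const_mul]
        congr 1; ext s
        rw [inner_smul_right, real_inner_comm]
        ring
    _ = _ := by rw [h3]; ring

theorem norm_integral_uniformSphere_sub_le (hd : 0 < d) {η : ℝ} (hη : 0 < η) {L : ℝ≥0}
    {f : EuclideanSpace ℝ (Fin d) → ℝ} (hf : LipschitzWith L f)
    (v w : EuclideanSpace ℝ (Fin d)) :
    ‖(∫ s, (d / η * f (v + η • s.1)) • s.1 ∂uniformSphere d) -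
      ∫ s, (d / η * f (w + η • s.1)) • s.1 ∂uniformSphere d‖ ≤ L * d / η * ‖v - w‖ := by
  have := isProbabilityMeasure_uniformSphere hd
  have hc := hf.continuous
  rw [← integral_sub (integrable_uniformSphere hd (by fun_prop))
    (integrable_uniformSphere hd (by fun_prop))]
  refine (norm_integral_le_of_norm_le_const (C := L * d / η * ‖v - w‖)
    (.of_forall fun s => ?_)).trans_eq (by simp)
  rw [← sub_smul, ← mul_sub, norm_smul, norm_mul, norm_eq_of_mem_sphere s, mul_one,
    Real.norm_of_nonneg (by positivity)]
  have h := hf.dist_le_mul (v + η • s.1) (w + η • s.1)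
  rw [dist_add_right, dist_eq_norm, dist_eq_norm] at h
  calc _ ≤ d / η * (L * ‖v - w‖) := by gcongr
    _ = _ := by ring

end SphereAverages

theorem memLp_two_of_norm_sq_le {α E : Type*} [MeasurableSpace α] [NormedAddCommGroup E]
    {ν : Measure α} [IsProbabilityMeasure ν] {h : α → ℝ} {g : α → E} {κ b : ℝ}
    (hh : MemLp h 2 ν) (hg : AEStronglyMeasurable g ν)
    (hle : ∀ p, ‖g p‖ ^ 2 ≤ κ * (2 * h p ^ 2 + b)) :
    MemLp g 2 ν ∧ ∫ p, ‖g p‖ ^ 2 ∂ν ≤ κ * (2 * ∫ p, h p ^ 2 ∂ν + b) := by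
  have hsq := hh.integrable_sq
  have hi : Integrable (fun p => κ * (2 * h p ^ 2 + b)) ν :=
    ((hsq.const_mul 2).add (integrable_const _)).const_mul _
  have hi2 : Integrable (fun p => ‖g p‖ ^ 2) ν :=
    hi.mono' (hg.norm.pow 2) (.of_forall fun p => by
      rw [Real.norm_of_nonneg (sq_nonneg _)]; exact hle p)
  refine ⟨(memLp_two_iff_integrable_sq_norm hg).2 hi2, ?_⟩
  refine (integral_mono hi2 hi hle).trans_eq ?_
  rw [integral_const_mul, integral_add (hsq.const_mul 2) (integrable_const _), integral_const_mul]
  simp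

/-! ### The zeroth-order estimator: measurability, moments and mean. -/

namespace HierarchicalGame

section Estimator

variable {N : ℕ} {n m : Fin N → ℕ} {Ξ : Type*} [MeasurableSpace Ξ]
  (G : HierarchicalGame N n m Ξ) (i : Fin N)

theorem isClosed_strategies : IsClosed G.strategies := by
  have : G.strategies = ⋂ j, (fun x : ∀ j, EuclideanSpace ℝ (Fin (n j)) => x j) ⁻¹' G.X j := by
    ext x; simp [strategies]
  rw [this]
  exact isClosed_iInter fun j => (G.X_closed j).preimage (continuous_apply j)

theorem isClosed_enlarged (η : ℝ) : IsClosed (G.enlarged i η) :=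
  (G.X_closed i).add_right_of_isCompact (isCompact_closedBall _ _)

theorem isClosed_domain (η : ℝ) : IsClosed (G.domain i η) := by
  have : G.domain i η = (fun x : ∀ j, EuclideanSpace ℝ (Fin (n j)) => x i) ⁻¹' G.enlarged i η ∩
      ⋂ j, ⋂ _ : j ≠ i, (fun x : ∀ j, EuclideanSpace ℝ (Fin (n j)) => x j) ⁻¹' G.X j := by
    ext x; simp [domain]
  rw [this]
  exact ((G.isClosed_enlarged i η).preimage (continuous_apply i)).inter
    (isClosed_iInter fun j => isClosed_iInter fun _ => (G.X_closed j).preimage (continuous_apply j))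

variable {G i}

theorem add_smul_mem_enlarged {η : ℝ} (hη : 0 ≤ η) {v u : EuclideanSpace ℝ (Fin (n i))}
    (hv : v ∈ G.X i) (hu : ‖u‖ ≤ 1) : v + η • u ∈ G.enlarged i η := by
  refine add_mem_add hv ?_
  rw [mem_closedBall_zero_iff, norm_smul, Real.norm_of_nonneg hη]
  exact mul_le_of_le_one_right hη hu

theorem update_mem_domain {η : ℝ} {x : ∀ j, EuclideanSpace ℝ (Fin (n j))} (hx : x ∈ G.strategies)
    {z : EuclideanSpace ℝ (Fin (n i))} (hz : z ∈ G.enlarged i η) :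
    Function.update x i z ∈ G.domain i η := by
  refine ⟨by simpa using hz, fun j hj => ?_⟩
  rw [Function.update_of_ne hj]
  exact hx j

variable (G i)

/-- The sampled implicit objective, extended by zero to all profiles. -/
noncomputable def extObj (η : ℝ) (x : ∀ j, EuclideanSpace ℝ (Fin (n j))) (ξ : Ξ) : ℝ :=
  (G.domain i η).indicator (fun x => G.sampledObj i x ξ) x

/-- The zeroth-order gradient estimate built from the extended objective. -/
noncomputable def extGrad (η c : ℝ) (x : ∀ j, EuclideanSpace ℝ (Fin (n j)))
    (v : EuclideanSpace ℝ (Fin (n i)))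
    (p : Ξ × Metric.sphere (0 : EuclideanSpace ℝ (Fin (n i))) 1) :
    EuclideanSpace ℝ (Fin (n i)) :=
  (((n i : ℝ) / η) * (G.extObj i η (Function.update x i (v + η • p.2.1)) p.1
    + c / 2 * ‖v + η • p.2.1 - x i‖ ^ 2)) • p.2.1

/-- The expectation of the zeroth-order gradient estimate. -/
noncomputable def meanGrad (η c : ℝ) (x : ∀ j, EuclideanSpace ℝ (Fin (n j)))
    (v : EuclideanSpace ℝ (Fin (n i))) : EuclideanSpace ℝ (Fin (n i)) :=
  ∫ p, G.extGrad i η c x v p ∂(G.law.prod (uniformSphere (n i)))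

variable {G i}

theorem extObj_of_mem {η : ℝ} {x : ∀ j, EuclideanSpace ℝ (Fin (n j))} (hx : x ∈ G.domain i η)
    (ξ : Ξ) : G.extObj i η x ξ = G.sampledObj i x ξ :=
  indicator_of_mem hx _

theorem extGrad_eq_sampleGrad {η c : ℝ} (hη : 0 ≤ η) {x : ∀ j, EuclideanSpace ℝ (Fin (n j))}
    (hx : x ∈ G.strategies) {v : EuclideanSpace ℝ (Fin (n i))} (hv : v ∈ G.X i)
    (p : Ξ × Metric.sphere (0 : EuclideanSpace ℝ (Fin (n i))) 1) :
    G.extGrad i η c x v p = G.sampleGrad i η c x v p.1 p.2 := by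
  rw [extGrad, sampleGrad, extObj_of_mem (update_mem_domain hx
    (add_smul_mem_enlarged hη hv (norm_eq_of_mem_sphere p.2).le))]

/-- The hypothesis gives measurability only over `domain`; that set is closed, so extension by zero
is measurable on the whole space. -/
theorem measurable_extObj {η : ℝ}
    (hmeas : Measurable fun p : G.domain i η × Ξ => G.sampledObj i p.1.1 p.2) :
    Measurable fun p : (∀ j, EuclideanSpace ℝ (Fin (n j))) × Ξ => G.extObj i η p.1 p.2 := by
  have hD : MeasurableSet (G.domain i η ×ˢ (univ : Set Ξ)) :=
    (G.isClosed_domain i η).measurableSet.prod .univ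
  refine measurable_of_restrict_of_restrict_compl hD ?_ ?_
  · have : Measurable fun p : (G.domain i η ×ˢ (univ : Set Ξ) : Set _) =>
        ((⟨p.1.1, p.2.1⟩, p.1.2) : G.domain i η × Ξ) :=
      (measurable_subtype_coe.fst.subtype_mk).prodMk measurable_subtype_coe.snd
    convert hmeas.comp this using 1
    ext p
    exact extObj_of_mem p.2.1 _
  · convert measurable_const (a := (0 : ℝ)) using 1
    ext p
    have h : p.1.1 ∉ G.domain i η := fun h => p.2 ⟨h, mem_univ _⟩
    exact indicator_of_notMem h (fun x => G.sampledObj i x p.1.2)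

theorem measurable_extGrad {η : ℝ} (c : ℝ)
    (hmeas : Measurable fun p : G.domain i η × Ξ => G.sampledObj i p.1.1 p.2) :
    Measurable fun q : ((∀ j, EuclideanSpace ℝ (Fin (n j))) × EuclideanSpace ℝ (Fin (n i))) ×
      (Ξ × Metric.sphere (0 : EuclideanSpace ℝ (Fin (n i))) 1) =>
        G.extGrad i η c q.1.1 q.1.2 q.2 := by
  have h1 : Measurable fun q : ((∀ j, EuclideanSpace ℝ (Fin (n j))) ×
      EuclideanSpace ℝ (Fin (n i))) × (Ξ × Metric.sphere (0 : EuclideanSpace ℝ (Fin (n i))) 1) =>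
      Function.update q.1.1 i (q.1.2 + η • q.2.2.1) :=
    measurable_update'.comp (measurable_fst.fst.prodMk (by fun_prop))
  have h2 := (measurable_extObj hmeas).comp (h1.prodMk measurable_snd.fst)
  have h3 : Measurable fun q : ((∀ j, EuclideanSpace ℝ (Fin (n j))) ×
      EuclideanSpace ℝ (Fin (n i))) × (Ξ × Metric.sphere (0 : EuclideanSpace ℝ (Fin (n i))) 1) =>
      q.1.2 + η • q.2.2.1 - q.1.1 i := by fun_prop
  exact (((h2.add ((h3.norm.pow_const 2).const_mul (c / 2))).const_mul _).smul (by fun_prop))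

theorem measurable_extGrad_right {η : ℝ} (c : ℝ)
    (hmeas : Measurable fun p : G.domain i η × Ξ => G.sampledObj i p.1.1 p.2)
    (x : ∀ j, EuclideanSpace ℝ (Fin (n j))) (v : EuclideanSpace ℝ (Fin (n i))) :
    Measurable fun p => G.extGrad i η c x v p := by
  have h1 : Measurable fun p : Ξ × Metric.sphere (0 : EuclideanSpace ℝ (Fin (n i))) 1 =>
      ((x, v), p) := measurable_prodMk_left
  have h2 := (measurable_extGrad c hmeas).comp h1
  exact h2

theorem measurable_meanGrad (hn : 0 < n i) {η : ℝ} (c : ℝ)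
    (hmeas : Measurable fun p : G.domain i η × Ξ => G.sampledObj i p.1.1 p.2) :
    Measurable fun q : (∀ j, EuclideanSpace ℝ (Fin (n j))) × EuclideanSpace ℝ (Fin (n i)) =>
      G.meanGrad i η c q.1 q.2 := by
  have := isProbabilityMeasure_uniformSphere hn
  have := G.law_prob
  exact (measurable_extGrad c hmeas).stronglyMeasurable.integral_prod_right'.measurable

section Moments

variable {η : ℝ} {M : ℝ≥0}

theorem measurable_sampledObj
    (hmeas : Measurable fun p : G.domain i η × Ξ => G.sampledObj i p.1.1 p.2)
    {x : ∀ j, EuclideanSpace ℝ (Fin (n j))} (hx : x ∈ G.domain i η) :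
    Measurable (G.sampledObj i x) :=
  hmeas.comp (measurable_prodMk_left (x := (⟨x, hx⟩ : G.domain i η)))

theorem integrable_sampledObj
    (hmeas : Measurable fun p : G.domain i η × Ξ => G.sampledObj i p.1.1 p.2)
    (hmom : ∀ x ∈ G.domain i η, ∫⁻ ξ, ‖G.sampledObj i x ξ‖ₑ ^ 2 ∂G.law ≤ M)
    {x : ∀ j, EuclideanSpace ℝ (Fin (n j))} (hx : x ∈ G.domain i η) :
    Integrable (G.sampledObj i x) G.law := by
  have := G.law_prob
  refine MemLp.integrable one_le_two ⟨(measurable_sampledObj hmeas hx).aestronglyMeasurable, ?_⟩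
  rw [eLpNorm_lt_top_iff_lintegral_rpow_enorm_lt_top two_ne_zero ENNReal.ofNat_ne_top]
  simpa using (hmom x hx).trans_lt ENNReal.coe_lt_top

/-- The sampled objective along the sphere of radius `η`, as a function of both samples, is
square integrable with the same bound. -/
theorem memLp_extObj_sphere (hn : 0 < n i) (hη : 0 ≤ η)
    (hmeas : Measurable fun p : G.domain i η × Ξ => G.sampledObj i p.1.1 p.2)
    (hmom : ∀ x ∈ G.domain i η, ∫⁻ ξ, ‖G.sampledObj i x ξ‖ₑ ^ 2 ∂G.law ≤ M)
    {x : ∀ j, EuclideanSpace ℝ (Fin (n j))} (hx : x ∈ G.strategies)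
    {v : EuclideanSpace ℝ (Fin (n i))} (hv : v ∈ G.X i) :
    MemLp (fun p : Ξ × Metric.sphere (0 : EuclideanSpace ℝ (Fin (n i))) 1 =>
      G.extObj i η (Function.update x i (v + η • p.2.1)) p.1) 2
      (G.law.prod (uniformSphere (n i))) ∧
    ∫ p : Ξ × Metric.sphere (0 : EuclideanSpace ℝ (Fin (n i))) 1,
      G.extObj i η (Function.update x i (v + η • p.2.1)) p.1 ^ 2
      ∂(G.law.prod (uniformSphere (n i))) ≤ M := by
  have := isProbabilityMeasure_uniformSphere hn
  have := G.law_prob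
  have hm : Measurable fun p : Ξ × Metric.sphere (0 : EuclideanSpace ℝ (Fin (n i))) 1 =>
      G.extObj i η (Function.update x i (v + η • p.2.1)) p.1 :=
    (measurable_extObj hmeas).comp (((measurable_update x).comp
      (g := Function.update x i) (by fun_prop)).prodMk measurable_fst)
  have hle : ∫⁻ p : Ξ × Metric.sphere (0 : EuclideanSpace ℝ (Fin (n i))) 1,
      ‖G.extObj i η (Function.update x i (v + η • p.2.1)) p.1‖ₑ ^ 2
      ∂(G.law.prod (uniformSphere (n i))) ≤ M := by
    -- Integrate over the scenario first: for each direction the moment hypothesis applies at one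
    -- profile of `domain`.
    rw [lintegral_prod_symm' _ (hm.enorm.pow_const 2)]
    refine (lintegral_mono fun s => ?_).trans_eq
      (lintegral_const (μ := uniformSphere (n i)) (M : ℝ≥0∞) |>.trans (by simp))
    have hmem := update_mem_domain hx
      (add_smul_mem_enlarged hη hv (norm_eq_of_mem_sphere s).le)
    simp only [extObj_of_mem hmem]
    exact hmom _ hmem
  refine ⟨⟨hm.aestronglyMeasurable, ?_⟩, ?_⟩
  · rw [eLpNorm_lt_top_iff_lintegral_rpow_enorm_lt_top two_ne_zero ENNReal.ofNat_ne_top]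
    simpa using hle.trans_lt ENNReal.coe_lt_top
  · rw [integral_eq_lintegral_of_nonneg_ae (.of_forall fun p => sq_nonneg _)
      (hm.pow_const 2).aestronglyMeasurable]
    refine ENNReal.toReal_le_of_le_ofReal M.2 ?_
    rw [ENNReal.ofReal_coe_nnreal]
    refine le_trans (lintegral_mono fun p => ?_) hle
    rw [← Real.enorm_of_nonneg (sq_nonneg _), enorm_pow]

theorem norm_extGrad_sq_le (hη : 0 ≤ η) {c R : ℝ} (hc : 0 ≤ c) (hR : ∀ v ∈ G.X i, ‖v‖ ≤ R)
    {x : ∀ j, EuclideanSpace ℝ (Fin (n j))} (hx : x ∈ G.strategies)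
    {v : EuclideanSpace ℝ (Fin (n i))} (hv : v ∈ G.X i)
    (p : Ξ × Metric.sphere (0 : EuclideanSpace ℝ (Fin (n i))) 1) :
    ‖G.extGrad i η c x v p‖ ^ 2 ≤
      (n i / η) ^ 2 * (2 * G.extObj i η (Function.update x i (v + η • p.2.1)) p.1 ^ 2 +
        2 * (c / 2 * (2 * R + η) ^ 2) ^ 2) := by
  have hn1 : ‖v + η • p.2.1 - x i‖ ≤ 2 * R + η := by
    have e1 := norm_sub_le (v + η • p.2.1) (x i)
    have e2 := norm_add_le v (η • p.2.1)
    rw [norm_smul, norm_eq_of_mem_sphere p.2, Real.norm_of_nonneg hη, mul_one] at e2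
    linarith [hR v hv, hR _ (hx i)]
  have hb : c / 2 * ‖v + η • p.2.1 - x i‖ ^ 2 ≤ c / 2 * (2 * R + η) ^ 2 := by gcongr
  have hb0 : 0 ≤ c / 2 * ‖v + η • p.2.1 - x i‖ ^ 2 := by positivity
  rw [extGrad, norm_smul, norm_eq_of_mem_sphere p.2, mul_one, Real.norm_eq_abs, sq_abs, mul_pow]
  refine mul_le_mul_of_nonneg_left ((add_sq_le).trans ?_) (sq_nonneg _)
  rw [mul_add]
  gcongr

theorem memLp_extGrad (hn : 0 < n i) (hη : 0 ≤ η) {c R : ℝ} (hc : 0 ≤ c)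
    (hmeas : Measurable fun p : G.domain i η × Ξ => G.sampledObj i p.1.1 p.2)
    (hmom : ∀ x ∈ G.domain i η, ∫⁻ ξ, ‖G.sampledObj i x ξ‖ₑ ^ 2 ∂G.law ≤ M)
    (hR : ∀ v ∈ G.X i, ‖v‖ ≤ R)
    {x : ∀ j, EuclideanSpace ℝ (Fin (n j))} (hx : x ∈ G.strategies)
    {v : EuclideanSpace ℝ (Fin (n i))} (hv : v ∈ G.X i) :
    MemLp (G.extGrad i η c x v) 2 (G.law.prod (uniformSphere (n i))) ∧
    ∫ p, ‖G.extGrad i η c x v p‖ ^ 2 ∂(G.law.prod (uniformSphere (n i))) ≤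
      (n i / η) ^ 2 * (2 * M + 2 * (c / 2 * (2 * R + η) ^ 2) ^ 2) := by
  have := isProbabilityMeasure_uniformSphere hn
  have := G.law_prob
  obtain ⟨h1, h2⟩ := memLp_extObj_sphere hn hη hmeas hmom hx hv
  have hm := measurable_extGrad_right c hmeas x v
  obtain ⟨h3, h4⟩ := memLp_two_of_norm_sq_le h1 hm.aestronglyMeasurable
    (norm_extGrad_sq_le hη hc hR hx hv)
  refine ⟨h3, h4.trans ?_⟩
  gcongr

end Moments

section MeanGradient

variable {η c : ℝ} {M L₀ : ℝ≥0}

/-- A global Lipschitz extension `f` of the objective makes the smoothing formulas, stated for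
functions on the whole space, applicable. Averaging over scenarios first leaves the sphere average
of `f`, while the quadratic part contributes its exact gradient. -/
theorem exists_lipschitz_meanGrad_eq (hn : 0 < n i) (hη : 0 < η) (hc : 0 ≤ c)
    (hX : Bornology.IsBounded (G.X i))
    (hmeas : Measurable fun p : G.domain i η × Ξ => G.sampledObj i p.1.1 p.2)
    (hmom : ∀ x ∈ G.domain i η, ∫⁻ ξ, ‖G.sampledObj i x ξ‖ₑ ^ 2 ∂G.law ≤ M)
    {x : ∀ j, EuclideanSpace ℝ (Fin (n j))} (hx : x ∈ G.strategies)
    (hLip : LipschitzOnWith L₀ (fun z => G.obj i (Function.update x i z)) (G.enlarged i η)) :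
    ∃ f : EuclideanSpace ℝ (Fin (n i)) → ℝ, LipschitzWith L₀ f ∧
      (∀ z ∈ G.enlarged i η, G.obj i (Function.update x i z) = f z) ∧
      ∀ v ∈ G.X i, G.meanGrad i η c x v =
        (∫ s, (n i / η * f (v + η • s.1)) • s.1 ∂uniformSphere (n i)) + c • (v - x i) := by
  have := isProbabilityMeasure_uniformSphere hn
  have := G.law_prob
  obtain ⟨R, hR⟩ := hX.exists_norm_le
  obtain ⟨f, hf, heq⟩ := hLip.extend_real
  have hfc := hf.continuous
  refine ⟨f, hf, heq, fun v hv => ?_⟩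
  rw [meanGrad, integral_prod_symm _
    ((memLp_extGrad hn hη.le hc hmeas hmom hR hx hv).1.integrable one_le_two),
    ← integral_uniformSphere_quadratic_smul hn hη c v (x i),
    ← integral_add (integrable_uniformSphere hn (by fun_prop))
      (integrable_uniformSphere hn (by fun_prop))]
  refine integral_congr_ae (.of_forall fun s => ?_)
  have hz := add_smul_mem_enlarged hη.le hv (norm_eq_of_mem_sphere s).le
  have hmem := update_mem_domain hx hz
  simp only [extGrad, extObj_of_mem hmem]
  rw [integral_smul_const, integral_const_mul,
    integral_add (integrable_sampledObj hmeas hmom hmem) (integrable_const _)]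
  simp only [integral_const, probReal_univ, one_smul]
  rw [← add_smul, ← mul_add, ← heq hz]
  rfl

theorem norm_meanGrad_sub_le (hn : 0 < n i) (hη : 0 < η) (hc : 0 ≤ c)
    (hX : Bornology.IsBounded (G.X i))
    (hmeas : Measurable fun p : G.domain i η × Ξ => G.sampledObj i p.1.1 p.2)
    (hmom : ∀ x ∈ G.domain i η, ∫⁻ ξ, ‖G.sampledObj i x ξ‖ₑ ^ 2 ∂G.law ≤ M)
    {x : ∀ j, EuclideanSpace ℝ (Fin (n j))} (hx : x ∈ G.strategies)
    (hLip : LipschitzOnWith L₀ (fun z => G.obj i (Function.update x i z)) (G.enlarged i η))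
    {v w : EuclideanSpace ℝ (Fin (n i))} (hv : v ∈ G.X i) (hw : w ∈ G.X i) :
    ‖G.meanGrad i η c x v - G.meanGrad i η c x w‖ ≤ (L₀ * n i / η + c) * ‖v - w‖ := by
  obtain ⟨f, hf, -, hgrad⟩ := exists_lipschitz_meanGrad_eq hn hη hc hX hmeas hmom hx hLip
  rw [hgrad v hv, hgrad w hw, add_sub_add_comm, ← smul_sub, sub_sub_sub_cancel_right, add_mul]
  refine (norm_add_le _ _).trans (add_le_add (norm_integral_uniformSphere_sub_le hn hη hf v w) ?_)
  rw [norm_smul, Real.norm_of_nonneg hc]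

/-- Along segments in the strategy set, the proximal objective has the gradient `meanGrad`. -/
theorem hasDerivWithinAt_proxObj (hn : 0 < n i) (hη : 0 < η) (hc : 0 ≤ c)
    (hX : Bornology.IsBounded (G.X i))
    (hmeas : Measurable fun p : G.domain i η × Ξ => G.sampledObj i p.1.1 p.2)
    (hmom : ∀ x ∈ G.domain i η, ∫⁻ ξ, ‖G.sampledObj i x ξ‖ₑ ^ 2 ∂G.law ≤ M)
    {x : ∀ j, EuclideanSpace ℝ (Fin (n j))} (hx : x ∈ G.strategies)
    (hLip : LipschitzOnWith L₀ (fun z => G.obj i (Function.update x i z)) (G.enlarged i η))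
    {v w : EuclideanSpace ℝ (Fin (n i))} (hv : v ∈ G.X i) (hw : w ∈ G.X i) :
    HasDerivWithinAt (fun t : ℝ => G.proxObj i η c (v + t • (w - v)) x)
      (inner ℝ (G.meanGrad i η c x v) (w - v)) (Icc 0 1) 0 := by
  obtain ⟨f, hf, heq, hgrad⟩ := exists_lipschitz_meanGrad_eq hn hη hc hX hmeas hmom hx hLip
  have hfc := hf.continuous
  have h1 := hasDerivAt_setAverage_closedBall hn hfc hη v (w - v)
  have h2 : HasDerivAt (fun t : ℝ => c / 2 * ‖v + t • (w - v) - x i‖ ^ 2)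
      (c * inner ℝ (v - x i) (w - v)) 0 := by
    have h : HasDerivAt (fun t : ℝ => v + t • (w - v) - x i) (w - v) 0 := by
      simpa using (((hasDerivAt_id (0 : ℝ)).smul_const (w - v)).const_add v).sub_const (x i)
    refine (h.norm_sq.const_mul (c / 2)).congr_deriv ?_
    simp only [zero_smul, add_zero]
    ring
  have key : ∀ t ∈ Icc (0 : ℝ) 1, G.proxObj i η c (v + t • (w - v)) x =
      (⨍ u in Metric.closedBall (0 : EuclideanSpace ℝ (Fin (n i))) 1,
        f (v + t • (w - v) + η • u)) + c / 2 * ‖v + t • (w - v) - x i‖ ^ 2 := fun t ht => by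
    rw [proxObj, smoothedObj, setAverage_eq, setAverage_eq]
    congr 2
    refine setIntegral_congr_fun Metric.isClosed_closedBall.measurableSet fun u hu => ?_
    simp only [Function.update_self, Function.update_idem]
    exact heq _ (add_smul_mem_enlarged hη.le ((G.X_convex i).add_smul_sub_mem hv hw ht)
      (mem_closedBall_zero_iff.1 hu))
  refine ((h1.add h2).congr_deriv ?_).hasDerivWithinAt.congr key (key 0 (by simp))
  rw [hgrad v hv, inner_add_left, inner_smul_left, conj_trivial,
    real_inner_comm (w - v) (∫ s, _ ∂_),
    ← integral_inner (integrable_uniformSphere hn (by fun_prop))]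
  congr 2; ext s
  rw [inner_smul_right, real_inner_comm]

/-- Sum of the strong convexity inequalities at `v` and at `w`. -/
theorem inner_meanGrad_sub_ge (hn : 0 < n i) (hη : 0 < η) (hc : 0 ≤ c)
    (hX : Bornology.IsBounded (G.X i))
    (hmeas : Measurable fun p : G.domain i η × Ξ => G.sampledObj i p.1.1 p.2)
    (hmom : ∀ x ∈ G.domain i η, ∫⁻ ξ, ‖G.sampledObj i x ξ‖ₑ ^ 2 ∂G.law ≤ M)
    {x : ∀ j, EuclideanSpace ℝ (Fin (n j))} (hx : x ∈ G.strategies)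
    (hLip : LipschitzOnWith L₀ (fun z => G.obj i (Function.update x i z)) (G.enlarged i η))
    (hconv : StrongConvexOn (G.X i) c fun v => G.proxObj i η c v x)
    {v w : EuclideanSpace ℝ (Fin (n i))} (hv : v ∈ G.X i) (hw : w ∈ G.X i) :
    c * ‖v - w‖ ^ 2 ≤ inner ℝ (G.meanGrad i η c x v - G.meanGrad i η c x w) (v - w) := by
  have h1 := hconv.add_inner_add_le hv hw
    (hasDerivWithinAt_proxObj hn hη hc hX hmeas hmom hx hLip hv hw)
  have h2 := hconv.add_inner_add_le hw hv
    (hasDerivWithinAt_proxObj hn hη hc hX hmeas hmom hx hLip hw hv)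
  rw [norm_sub_rev w v, ← neg_sub v w, inner_neg_right] at h1
  rw [inner_sub_left]
  linarith

/-- One projected step contracts towards the minimizer, up to the error of the gradient
estimate. -/
theorem norm_euclProj_sub_minimizer_le (hn : 0 < n i) (hη : 0 < η) (hc : 0 ≤ c)
    (hX : Bornology.IsBounded (G.X i))
    (hmeas : Measurable fun p : G.domain i η × Ξ => G.sampledObj i p.1.1 p.2)
    (hmom : ∀ x ∈ G.domain i η, ∫⁻ ξ, ‖G.sampledObj i x ξ‖ₑ ^ 2 ∂G.law ≤ M)
    {x : ∀ j, EuclideanSpace ℝ (Fin (n j))} (hx : x ∈ G.strategies)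
    (hLip : LipschitzOnWith L₀ (fun z => G.obj i (Function.update x i z)) (G.enlarged i η))
    (hconv : StrongConvexOn (G.X i) c fun v => G.proxObj i η c v x)
    {ζ : ℝ} (hζ : 0 ≤ ζ) {y : EuclideanSpace ℝ (Fin (n i))} (hy : y ∈ G.X i)
    (hmin : IsMinOn (fun v => G.proxObj i η c v x) (G.X i) y)
    {v : EuclideanSpace ℝ (Fin (n i))} (hv : v ∈ G.X i) :
    (∀ γ, ‖euclProj (G.X i) (v - ζ • γ) - y‖ ≤
      ‖(v - y + ζ • G.meanGrad i η c x y) - ζ • γ‖) ∧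
    ‖(v - y + ζ • G.meanGrad i η c x y) - ζ • G.meanGrad i η c x v‖ ^ 2 ≤
      (1 - 2 * c * ζ + ζ ^ 2 * (L₀ * n i / η + c) ^ 2) * ‖v - y‖ ^ 2 := by
  refine ⟨fun γ => ?_, ?_⟩
  -- By first-order optimality, `y` is the projection of `y - ζ • meanGrad y`.
  · refine (norm_euclProj_sub_le (G.X_nonempty i) (G.X_closed i) (G.X_convex i) _ hy
      (z' := y - ζ • G.meanGrad i η c x y) fun w hw => ?_).trans_eq (by congr 1; abel)
    have := inner_sub_nonneg_of_isMinOn (G.X_convex i) hmin hy hw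
      (hasDerivWithinAt_proxObj hn hη hc hX hmeas hmom hx hLip hy hw)
    rw [sub_sub_cancel_left, inner_neg_left, inner_smul_left, conj_trivial]
    linarith [mul_nonneg hζ this]
  · refine le_of_eq_of_le (by congr 2; rw [smul_sub]; abel) (norm_sub_sub_smul_sq_le hζ
      (inner_meanGrad_sub_ge hn hη hc hX hmeas hmom hx hLip hconv hv hy)
      (norm_meanGrad_sub_le hn hη hc hX hmeas hmom hx hLip hv hy))

end MeanGradient

end Estimator

end HierarchicalGame

/-! ### Measurability of the minimizer and the stochastic recursion. -/

namespace HierarchicalGame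

section Convergence

variable {N : ℕ} {n m : Fin N → ℕ} {Ξ : Type*} [MeasurableSpace Ξ]
  {G : HierarchicalGame N n m Ξ} {i : Fin N} {η c ζ : ℝ} {M L₀ : ℝ≥0}

variable (G i) in
/-- The deterministic projected gradient iteration for the smoothed proximal problem. -/
noncomputable def meanIter (η c ζ : ℝ) (v₀ : EuclideanSpace ℝ (Fin (n i))) :
    ℕ → (∀ j, EuclideanSpace ℝ (Fin (n j))) → EuclideanSpace ℝ (Fin (n i))
  | 0, _ => v₀
  | k + 1, x => euclProj (G.X i) (meanIter η c ζ v₀ k x -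
      ζ • G.meanGrad i η c x (meanIter η c ζ v₀ k x))

theorem measurable_meanIter (hn : 0 < n i)
    (hmeas : Measurable fun p : G.domain i η × Ξ => G.sampledObj i p.1.1 p.2)
    (v₀ : EuclideanSpace ℝ (Fin (n i))) (k : ℕ) : Measurable (G.meanIter i η c ζ v₀ k) := by
  induction k with
  | zero => exact measurable_const
  | succ k ih =>
    have h1 := (measurable_meanGrad hn c hmeas).comp (measurable_id.prodMk ih)
    exact (continuous_euclProj (G.X_nonempty i) (G.X_closed i) (G.X_convex i)).measurable.comp
      (ih.sub (h1.const_smul ζ))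

/-- Replacing `α²` by the smaller `c²` leaves the square `(1 - cζ)²`. -/
theorem contraction_rate_nonneg {c α ζ : ℝ} (hαc : c ^ 2 ≤ α ^ 2) :
    0 ≤ 1 - 2 * c * ζ + ζ ^ 2 * α ^ 2 := by
  nlinarith [sq_nonneg (1 - c * ζ), mul_le_mul_of_nonneg_left hαc (sq_nonneg ζ)]

/-- The solution map of the smoothed proximal problem is measurable on the joint strategy set. -/
theorem measurable_indicator_minimizer (hn : 0 < n i) (hη : 0 < η) (hc : 0 ≤ c)
    (hX : Bornology.IsBounded (G.X i))
    (hmeas : Measurable fun p : G.domain i η × Ξ => G.sampledObj i p.1.1 p.2)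
    (hmom : ∀ x ∈ G.domain i η, ∫⁻ ξ, ‖G.sampledObj i x ξ‖ₑ ^ 2 ∂G.law ≤ M)
    (hLip : ∀ x ∈ G.strategies,
      LipschitzOnWith L₀ (fun z => G.obj i (Function.update x i z)) (G.enlarged i η))
    (hconv : ∀ x ∈ G.strategies, StrongConvexOn (G.X i) c fun v => G.proxObj i η c v x)
    (hζ : 0 ≤ ζ) (hrate : 1 - 2 * c * ζ + ζ ^ 2 * (L₀ * n i / η + c) ^ 2 < 1)
    (vstar : (∀ j, EuclideanSpace ℝ (Fin (n j))) → EuclideanSpace ℝ (Fin (n i)))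
    (hvstar : ∀ x ∈ G.strategies, vstar x ∈ G.X i ∧
      IsMinOn (fun v => G.proxObj i η c v x) (G.X i) (vstar x)) :
    Measurable (G.strategies.indicator vstar) := by
  obtain ⟨v₀, hv₀⟩ := G.X_nonempty i
  refine measurable_of_tendsto_metrizable (f := fun k => G.strategies.indicator
    (G.meanIter i η c ζ v₀ k)) (fun k => (measurable_meanIter hn hmeas v₀ k).indicator
      G.isClosed_strategies.measurableSet) (tendsto_pi_nhds.2 fun x => ?_)
  by_cases hx : x ∈ G.strategies
  · simp only [indicator_of_mem hx]
    set q' := 1 - 2 * c * ζ + ζ ^ 2 * (L₀ * n i / η + c) ^ 2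
    have hq' : 0 ≤ q' := contraction_rate_nonneg (pow_le_pow_left₀ hc
      (le_add_of_nonneg_left (by positivity)) 2)
    have hmem : ∀ k, G.meanIter i η c ζ v₀ k x ∈ G.X i := fun k => by
      cases k with
      | zero => exact hv₀
      | succ k => exact euclProj_mem (G.X_nonempty i) (G.X_closed i) (G.X_convex i) _
    have hle : ∀ k, ‖G.meanIter i η c ζ v₀ k x - vstar x‖ ^ 2 ≤ q' ^ k * ‖v₀ - vstar x‖ ^ 2 := by
      intro k
      induction k with
      | zero => simp [meanIter]
      | succ k ih =>
        obtain ⟨h1, h2⟩ := norm_euclProj_sub_minimizer_le hn hη hc hX hmeas hmom hx (hLip x hx)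
          (hconv x hx) hζ (hvstar x hx).1 (hvstar x hx).2 (hmem k)
        calc _ ≤ _ := pow_le_pow_left₀ (norm_nonneg _) (h1 _) 2
          _ ≤ _ := h2
          _ ≤ q' * (q' ^ k * ‖v₀ - vstar x‖ ^ 2) := by gcongr
          _ = _ := by ring
    have hlim : Filter.Tendsto (fun k => ‖G.meanIter i η c ζ v₀ k x - vstar x‖ ^ 2) Filter.atTop
        (nhds 0) := by
      refine squeeze_zero (fun k => sq_nonneg _) hle ?_
      simpa using (tendsto_pow_atTop_nhds_zero_of_lt_one hq' hrate).mul_const (‖v₀ - vstar x‖ ^ 2)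
    rw [tendsto_iff_norm_sub_tendsto_zero]
    simpa using hlim.sqrt
  · simp only [indicator_of_notMem hx]
    exact tendsto_const_nhds

/-- The expected error after one step of the scheme from a fixed point. -/
theorem integral_norm_step_sub_minimizer_sq_le (hn : 0 < n i) (hη : 0 < η) (hc : 0 ≤ c)
    (hX : Bornology.IsBounded (G.X i)) {R : ℝ} (hR : ∀ v ∈ G.X i, ‖v‖ ≤ R)
    (hmeas : Measurable fun p : G.domain i η × Ξ => G.sampledObj i p.1.1 p.2)
    (hmom : ∀ x ∈ G.domain i η, ∫⁻ ξ, ‖G.sampledObj i x ξ‖ₑ ^ 2 ∂G.law ≤ M)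
    {x : ∀ j, EuclideanSpace ℝ (Fin (n j))} (hx : x ∈ G.strategies)
    (hLip : LipschitzOnWith L₀ (fun z => G.obj i (Function.update x i z)) (G.enlarged i η))
    (hconv : StrongConvexOn (G.X i) c fun v => G.proxObj i η c v x)
    (hζ : 0 ≤ ζ) {y : EuclideanSpace ℝ (Fin (n i))} (hy : y ∈ G.X i)
    (hmin : IsMinOn (fun v => G.proxObj i η c v x) (G.X i) y)
    {v : EuclideanSpace ℝ (Fin (n i))} (hv : v ∈ G.X i)
    {Ω : Type*} [MeasurableSpace Ω] {μ : Measure Ω} [IsProbabilityMeasure μ]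
    {W : ℕ → Ω → Ξ × Metric.sphere (0 : EuclideanSpace ℝ (Fin (n i))) 1}
    (hW : ∀ j, Measurable (W j)) (hlaw : ∀ j, μ.map (W j) = G.law.prod (uniformSphere (n i)))
    (hind : Pairwise fun j k => IndepFun (W j) (W k) μ) {B : ℕ} (hB : 0 < B) :
    ∫ ω, ‖euclProj (G.X i) (v - ζ • ((B : ℝ)⁻¹ • ∑ j ∈ Finset.range B,
        G.extGrad i η c x v (W j ω))) - y‖ ^ 2 ∂μ ≤
      (1 - 2 * c * ζ + ζ ^ 2 * (L₀ * n i / η + c) ^ 2) * ‖v - y‖ ^ 2 +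
      ζ ^ 2 * ((n i / η) ^ 2 * (2 * M + 2 * (c / 2 * (2 * R + η) ^ 2) ^ 2)) / B := by
  obtain ⟨h1, h2⟩ := norm_euclProj_sub_minimizer_le hn hη hc hX hmeas hmom hx hLip hconv hζ hy
    hmin hv
  obtain ⟨hL, hK⟩ := memLp_extGrad hn hη.le hc hmeas hmom hR hx hv
  have hm := measurable_extGrad_right c hmeas x v
  have hYL : ∀ j, MemLp (fun ω => G.extGrad i η c x v (W j ω)) 2 μ := fun j =>
    MemLp.comp_of_map (g := G.extGrad i η c x v) (by rw [hlaw]; exact hL) (hW j).aemeasurable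
  -- The base vector `v - y + ζ • meanGrad y` is deterministic; with the estimates' mean `meanGrad
  -- v`, its mean step is the one contracted by `h2`.
  have hstep := integral_norm_sub_smul_average_sq_le hYL (g := G.meanGrad i η c x v)
    (K := (n i / η) ^ 2 * (2 * M + 2 * (c / 2 * (2 * R + η) ^ 2) ^ 2))
    (fun j => by
      rw [← integral_map (hW j).aemeasurable hm.aestronglyMeasurable, hlaw, meanGrad])
    (fun j => by
      rw [← integral_map (f := fun p => ‖G.extGrad i η c x v p‖ ^ 2) (hW j).aemeasurable
        (hm.norm.pow_const 2).aestronglyMeasurable, hlaw]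
      exact hK)
    (fun j k hjk => (hind hjk).comp hm hm) hB (v - y + ζ • G.meanGrad i η c x y) ζ
  refine le_trans (integral_mono_of_nonneg (.of_forall fun ω => sq_nonneg _) ?_
    (.of_forall fun ω => pow_le_pow_left₀ (norm_nonneg _) (h1 _) 2)) (hstep.trans ?_)
  · have hsum : MemLp (fun ω => ∑ j ∈ Finset.range B, G.extGrad i η c x v (W j ω)) 2 μ :=
      memLp_finsetSum _ fun j _ => hYL j
    have hS : MemLp (fun ω => (v - y + ζ • G.meanGrad i η c x y) -
        ζ • ((B : ℝ)⁻¹ • ∑ j ∈ Finset.range B, G.extGrad i η c x v (W j ω))) 2 μ :=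
      (memLp_const _).sub ((hsum.const_smul ((B : ℝ)⁻¹)).const_smul ζ)
    exact hS.integrable_norm_pow two_ne_zero
  · gcongr

section Scheme

variable {Ω : Type*} {x : Ω → ∀ j, EuclideanSpace ℝ (Fin (n j))} {v₀ : Ω → EuclideanSpace ℝ (Fin (n i))}
  {W : ℕ × ℕ → Ω → Ξ × Metric.sphere (0 : EuclideanSpace ℝ (Fin (n i))) 1}
  {B : ℕ → ℕ} {v : ℕ → Ω → EuclideanSpace ℝ (Fin (n i))}

/-- Only samples with first index below `t` enter the iterate; this is what makes it independent of
batch `t`. -/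
theorem exists_measurable_factor
    (hmeas : Measurable fun p : G.domain i η × Ξ => G.sampledObj i p.1.1 p.2)
    (hv0 : v 0 = v₀)
    (hv : ∀ t ω, v (t + 1) ω = euclProj (G.X i) (v t ω - ζ • ((B t : ℝ)⁻¹ •
      ∑ j ∈ Finset.range (B t), G.extGrad i η c (x ω) (v t ω) (W (t, j) ω)))) (t : ℕ) :
    ∃ V : ((∀ j, EuclideanSpace ℝ (Fin (n j))) × EuclideanSpace ℝ (Fin (n i))) ×
        ({p : ℕ × ℕ | p.1 < t} → Ξ × Metric.sphere (0 : EuclideanSpace ℝ (Fin (n i))) 1) →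
        EuclideanSpace ℝ (Fin (n i)),
      Measurable V ∧ ∀ ω, v t ω = V ((x ω, v₀ ω), fun p => W p ω) := by
  induction t with
  | zero => exact ⟨fun z => z.1.2, measurable_fst.snd, fun ω => by rw [hv0]⟩
  | succ t ih =>
    obtain ⟨V, hV, hvV⟩ := ih
    have hr : Measurable fun z : ((∀ j, EuclideanSpace ℝ (Fin (n j))) ×
        EuclideanSpace ℝ (Fin (n i))) × ({p : ℕ × ℕ | p.1 < t + 1} →
          Ξ × Metric.sphere (0 : EuclideanSpace ℝ (Fin (n i))) 1) =>
        (z.1, fun p : {p : ℕ × ℕ | p.1 < t} => z.2 ⟨p.1, Nat.lt_succ_of_lt p.2⟩) :=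
      measurable_fst.prodMk (measurable_pi_lambda _ fun p =>
        (measurable_pi_apply _).comp measurable_snd)
    have hV' := hV.comp hr
    have hs : ∀ j, Measurable fun z : ((∀ j, EuclideanSpace ℝ (Fin (n j))) ×
        EuclideanSpace ℝ (Fin (n i))) × ({p : ℕ × ℕ | p.1 < t + 1} →
          Ξ × Metric.sphere (0 : EuclideanSpace ℝ (Fin (n i))) 1) =>
        z.2 ⟨(t, j), Nat.lt_succ_self t⟩ := fun j =>
      (measurable_pi_apply _).comp measurable_snd
    refine ⟨_, (continuous_euclProj (G.X_nonempty i) (G.X_closed i) (G.X_convex i)).measurable.comp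
      (hV'.sub (((Finset.measurable_sum (Finset.range (B t)) fun j _ =>
        (measurable_extGrad c hmeas).comp
          ((measurable_fst.fst.prodMk hV').prodMk (hs j))).const_smul ((B t : ℝ)⁻¹)).const_smul ζ)),
      fun ω => ?_⟩
    rw [hv, hvV]
    simp only [Function.comp_apply, Pi.sub_apply, Pi.smul_apply]

variable [MeasurableSpace Ω] {μ : Measure Ω} [IsProbabilityMeasure μ]

/-- The one-step recursion for the mean square error on an event determined by `x`. -/
theorem setIntegral_norm_scheme_sub_minimizer_sq_le (hn : 0 < n i) (hη : 0 < η) (hc : 0 ≤ c)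
    (hX : Bornology.IsBounded (G.X i)) {R : ℝ} (hR : ∀ v ∈ G.X i, ‖v‖ ≤ R)
    (hmeas : Measurable fun p : G.domain i η × Ξ => G.sampledObj i p.1.1 p.2)
    (hmom : ∀ x ∈ G.domain i η, ∫⁻ ξ, ‖G.sampledObj i x ξ‖ₑ ^ 2 ∂G.law ≤ M)
    (hLip : ∀ x ∈ G.strategies,
      LipschitzOnWith L₀ (fun z => G.obj i (Function.update x i z)) (G.enlarged i η))
    (hconv : ∀ x ∈ G.strategies, StrongConvexOn (G.X i) c fun v => G.proxObj i η c v x)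
    (hζ : 0 ≤ ζ)
    {vstar : (∀ j, EuclideanSpace ℝ (Fin (n j))) → EuclideanSpace ℝ (Fin (n i))}
    (hvm : Measurable (G.strategies.indicator vstar))
    (hvstar : ∀ x ∈ G.strategies, vstar x ∈ G.X i ∧
      IsMinOn (fun v => G.proxObj i η c v x) (G.X i) (vstar x))
    (hx : Measurable x) (hxs : ∀ ω, x ω ∈ G.strategies)
    (hv₀ : Measurable v₀) (hW : ∀ p, Measurable (W p))
    (hlaw : ∀ p, μ.map (W p) = G.law.prod (uniformSphere (n i)))
    (hind : iIndepFun W μ) (hindx : IndepFun (fun ω => (x ω, v₀ ω)) (fun ω p => W p ω) μ)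
    (hB : ∀ t, 0 < B t) (hv0 : v 0 = v₀) (hvX : ∀ t ω, v t ω ∈ G.X i)
    (hv : ∀ t ω, v (t + 1) ω = euclProj (G.X i) (v t ω - ζ • ((B t : ℝ)⁻¹ •
      ∑ j ∈ Finset.range (B t), G.extGrad i η c (x ω) (v t ω) (W (t, j) ω)))) (t : ℕ)
    {A : Set (∀ j, EuclideanSpace ℝ (Fin (n j)))} (hA : MeasurableSet A) :
    ∫ ω in x ⁻¹' A, ‖v (t + 1) ω - vstar (x ω)‖ ^ 2 ∂μ ≤
      (1 - 2 * c * ζ + ζ ^ 2 * (L₀ * n i / η + c) ^ 2) *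
        ∫ ω in x ⁻¹' A, ‖v t ω - vstar (x ω)‖ ^ 2 ∂μ +
      ζ ^ 2 * ((n i / η) ^ 2 * (2 * M + 2 * (c / 2 * (2 * R + η) ^ 2) ^ 2)) / B t *
        μ.real (x ⁻¹' A) := by
  set κ := 1 - 2 * c * ζ + ζ ^ 2 * (L₀ * n i / η + c) ^ 2
  set K := ζ ^ 2 * ((n i / η) ^ 2 * (2 * M + 2 * (c / 2 * (2 * R + η) ^ 2) ^ 2)) / B t
  have hvs : ∀ ω, G.strategies.indicator vstar (x ω) = vstar (x ω) := fun ω =>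
    indicator_of_mem (hxs ω) _
  obtain ⟨V, hV, hvV⟩ := exists_measurable_factor hmeas hv0 hv t
  have hvt : Measurable (v t) := by
    rw [show v t = fun ω => V ((x ω, v₀ ω), fun p => W p ω) from funext hvV]
    exact hV.comp ((hx.prodMk hv₀).prodMk (measurable_pi_lambda _ fun p => hW p))
  have hdisj : Disjoint {p : ℕ × ℕ | p.1 < t} {p : ℕ × ℕ | p.1 = t} :=
    Set.disjoint_left.2 fun p (h1 : p.1 < t) (h2 : p.1 = t) => h1.ne h2
  have hindt : IndepFun (fun ω => (x ω, v t ω)) (fun ω (p : {p : ℕ × ℕ | p.1 = t}) => W p ω) μ := by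
    have h := (indepFun_prodMk_restrict (hx.prodMk hv₀) hW hind hindx hdisj).comp
      (measurable_fst.fst.prodMk hV) measurable_id
    simpa only [Function.comp_def, id, ← hvV] using h
  -- Squared error after one step, as a function of the frozen pair `(x, v t)` and the fresh batch.
  -- The indicator of `vstar` is measurable everywhere and agrees with `vstar` on the values of `x`.
  set Ψ : ((∀ j, EuclideanSpace ℝ (Fin (n j))) × EuclideanSpace ℝ (Fin (n i))) ×
      ({p : ℕ × ℕ | p.1 = t} → Ξ × Metric.sphere (0 : EuclideanSpace ℝ (Fin (n i))) 1) → ℝ :=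
    fun z => ‖euclProj (G.X i) (z.1.2 - ζ • ((B t : ℝ)⁻¹ • ∑ j ∈ Finset.range (B t),
      G.extGrad i η c z.1.1 z.1.2 (z.2 ⟨(t, j), rfl⟩))) - G.strategies.indicator vstar z.1.1‖ ^ 2
    with hΨ
  have hΨm : Measurable Ψ := by
    have hs : ∀ j, Measurable fun z : ((∀ j, EuclideanSpace ℝ (Fin (n j))) ×
        EuclideanSpace ℝ (Fin (n i))) × ({p : ℕ × ℕ | p.1 = t} →
          Ξ × Metric.sphere (0 : EuclideanSpace ℝ (Fin (n i))) 1) => z.2 ⟨(t, j), rfl⟩ := fun j =>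
      (measurable_pi_apply _).comp measurable_snd
    have hsum := Finset.measurable_sum (Finset.range (B t)) fun j _ =>
      (measurable_extGrad c hmeas).comp (measurable_fst.prodMk (hs j))
    have hproj := (continuous_euclProj (G.X_nonempty i) (G.X_closed i)
      (G.X_convex i)).measurable.comp
        (measurable_fst.snd.sub ((hsum.const_smul ((B t : ℝ)⁻¹)).const_smul ζ))
    exact (hproj.sub (hvm.comp measurable_fst.fst)).norm.pow_const 2
  have hΨv : ∀ ω, Ψ ((x ω, v t ω), fun p => W p ω) = ‖v (t + 1) ω - vstar (x ω)‖ ^ 2 := fun ω => by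
    simp only [hΨ, hv, hvs]
  have hbdd : ∀ s ω, ‖v s ω - vstar (x ω)‖ ^ 2 ≤ (R + R) ^ 2 := fun s ω =>
    pow_le_pow_left₀ (norm_nonneg _) ((norm_sub_le _ _).trans
      (add_le_add (hR _ (hvX s ω)) (hR _ (hvstar _ (hxs ω)).1))) 2
  have hvsm : Measurable fun ω => vstar (x ω) := by
    simpa only [Function.comp_def, hvs] using hvm.comp hx
  have hAm : MeasurableSet (x ⁻¹' A) := hx hA
  have hint : ∀ s, Measurable (v s) → Integrable (fun ω => ‖v s ω - vstar (x ω)‖ ^ 2) μ :=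
    fun s hs => Integrable.of_bound ((hs.sub hvsm).norm.pow_const 2).aestronglyMeasurable
      ((R + R) ^ 2) (.of_forall fun ω => by
        rw [Real.norm_of_nonneg (sq_nonneg _)]; exact hbdd s ω)
  have hvt1 : Integrable (fun ω => ‖v (t + 1) ω - vstar (x ω)‖ ^ 2) μ := by
    refine Integrable.of_bound ?_ ((R + R) ^ 2) (.of_forall fun ω => by
        rw [Real.norm_of_nonneg (sq_nonneg _)]; exact hbdd _ ω)
    simp only [← hΨv]
    exact (hΨm.comp ((hx.prodMk hvt).prodMk
      (measurable_pi_lambda _ fun p => hW p))).aestronglyMeasurable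
  -- The event depends on the frozen variable only, so it can be built into the integrand before
  -- freezing.
  set Φ := (fun z : ((∀ j, EuclideanSpace ℝ (Fin (n j))) × EuclideanSpace ℝ (Fin (n i))) ×
      ({p : ℕ × ℕ | p.1 = t} → Ξ × Metric.sphere (0 : EuclideanSpace ℝ (Fin (n i))) 1) =>
        z.1.1) ⁻¹' A |>.indicator Ψ with hΦ
  have hΦm : Measurable Φ := hΨm.indicator (measurable_fst.fst hA)
  have hΦv : ∀ ω ω', Φ ((x ω, v t ω), fun p => W p ω') =
      (x ⁻¹' A).indicator (fun ω => Ψ ((x ω, v t ω), fun p => W p ω')) ω := fun ω ω' => rfl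
  have hWt : Measurable fun ω (p : {p : ℕ × ℕ | p.1 = t}) => W p ω :=
    measurable_pi_lambda _ fun p => hW p
  obtain ⟨h1, h2⟩ := hindt.integral_eq_integral_integral (hx.prodMk hvt) hWt hΦm (by
      have h : (fun ω => Φ ((x ω, v t ω), fun p => W p ω)) =
          (x ⁻¹' A).indicator fun ω => ‖v (t + 1) ω - vstar (x ω)‖ ^ 2 := by
        ext ω
        rw [hΦv]
        simp only [indicator, hΨv]
      rw [h]
      exact hvt1.indicator hAm)
  calc ∫ ω in x ⁻¹' A, ‖v (t + 1) ω - vstar (x ω)‖ ^ 2 ∂μ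
      = ∫ ω, Φ ((x ω, v t ω), fun p => W p ω) ∂μ := by
        rw [← integral_indicator hAm]
        congr 1; ext ω
        rw [hΦv]
        simp only [indicator, hΨv]
    _ = ∫ ω, ∫ ω', Φ ((x ω, v t ω), fun p => W p ω') ∂μ ∂μ := h1
    _ ≤ ∫ ω, (x ⁻¹' A).indicator (fun ω => κ * ‖v t ω - vstar (x ω)‖ ^ 2 + K) ω ∂μ := by
        refine integral_mono h2
          ((((hint t hvt).const_mul κ).add (integrable_const K)).indicator hAm) fun ω => ?_
        by_cases hω : ω ∈ x ⁻¹' A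
        · simp only [hΦv, indicator_of_mem hω, hΨ, hvs]
          exact integral_norm_step_sub_minimizer_sq_le hn hη hc hX hR hmeas hmom (hxs ω)
            (hLip _ (hxs ω)) (hconv _ (hxs ω)) hζ (hvstar _ (hxs ω)).1 (hvstar _ (hxs ω)).2
            (hvX t ω) (W := fun j => W (t, j)) (fun j => hW _) (fun j => hlaw _)
            (fun j k hjk => hind.indepFun (by simpa using hjk)) (hB t)
        · simp only [hΦv, indicator_of_notMem hω, integral_zero, le_refl]
    _ = _ := by
        rw [integral_indicator hAm, integral_add ((hint t hvt).const_mul κ).integrableOn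
          (integrable_const K), integral_const_mul, setIntegral_const, smul_eq_mul, mul_comm K]

end Scheme

end Convergence

end HierarchicalGame

/-! ### The geometric rate. -/

theorem mainTheorem9 {N : ℕ} {n m : Fin N → ℕ} {Ξ : Type*} [MeasurableSpace Ξ]
    (G : HierarchicalGame N n m Ξ) (i : Fin N) (hn : 0 < n i)
    (η c ζ α q : ℝ) (L₀ M : ℝ≥0) (hη : 0 < η) (hc : 0 < c)
    -- the strategy set of player `i` is bounded
    (hX : Bornology.IsBounded (G.X i))
    -- the lower-level problem of player `i` has a unique solution
    (hlower : ∀ x ∈ G.domain i η, ∀ ξ, ∃! y, IsVISolution (G.Y i) (fun y' => G.F i y' x ξ) y)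
    -- the sampled implicit objective is measurable, with bounded second moments
    (hmeas : Measurable fun p : G.domain i η × Ξ => G.sampledObj i p.1.1 p.2)
    (hmom : ∀ x ∈ G.domain i η, ∫⁻ ξ, ‖G.sampledObj i x ξ‖ₑ ^ 2 ∂G.law ≤ M)
    -- the implicit objective is `L₀`-Lipschitz in the decision of player `i`
    (hLip : ∀ x ∈ G.strategies,
      LipschitzOnWith L₀ (fun z => G.obj i (Function.update x i z)) (G.enlarged i η))
    -- the smoothed proximal problem is `c`-strongly convex
    (hconv : ∀ x ∈ G.strategies, StrongConvexOn (G.X i) c fun v => G.proxObj i η c v x)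
    -- the smoothness constant, the step length and the rate
    (hα : α = L₀ * n i / η + c) (hζ : 0 < ζ) (hζ' : ζ < c / α ^ 2)
    (hq : q = 1 - 2 * c * ζ + 2 * ζ ^ 2 * α ^ 2)
    -- the solution of the smoothed proximal problem
    (vstar : (∀ j, EuclideanSpace ℝ (Fin (n j))) → EuclideanSpace ℝ (Fin (n i)))
    (hvstar : ∀ x ∈ G.strategies, vstar x ∈ G.X i ∧
      IsMinOn (fun v => G.proxObj i η c v x) (G.X i) (vstar x)) :
    ∃ C : ℝ, 0 < C ∧
      ∀ {Ω : Type*} [MeasurableSpace Ω] (μ : Measure Ω) [IsProbabilityMeasure μ]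
        (x : Ω → ∀ j, EuclideanSpace ℝ (Fin (n j))) (v₀ : Ω → EuclideanSpace ℝ (Fin (n i)))
        (ξ : ℕ → ℕ → Ω → Ξ)
        (s : ℕ → ℕ → Ω → Metric.sphere (0 : EuclideanSpace ℝ (Fin (n i))) 1),
        Measurable x → (∀ ω, x ω ∈ G.strategies) →
        Measurable v₀ → (∀ ω, v₀ ω ∈ G.X i) →
        (∀ t j, Measurable (ξ t j)) → (∀ t j, Measurable (s t j)) →
        -- every sample has the law of an independent pair of a scenario and a uniform direction
        (∀ t j, μ.map (fun ω => (ξ t j ω, s t j ω)) = G.law.prod (uniformSphere (n i))) →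
        -- the samples are independent of each other and of `(x, v₀)`
        iIndepFun (fun (p : ℕ × ℕ) ω => (ξ p.1 p.2 ω, s p.1 p.2 ω)) μ →
        IndepFun (fun ω => (x ω, v₀ ω))
          (fun ω (p : ℕ × ℕ) => (ξ p.1 p.2 ω, s p.1 p.2 ω)) μ →
        ∀ v : ℕ → Ω → EuclideanSpace ℝ (Fin (n i)),
        (∀ t ω, v t ω = G.zsol i η c ζ (fun k => ⌈(q ^ (k + 1))⁻¹⌉₊) (x ω) (v₀ ω)
          (fun k j => ξ k j ω) (fun k j => s k j ω) t) →
        ∀ t : ℕ,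
          Integrable (fun ω => ‖v t ω - vstar (x ω)‖ ^ 2) μ ∧
          ∀ᵐ ω ∂μ, (μ[fun ω' => ‖v t ω' - vstar (x ω')‖ ^ 2 |
            MeasurableSpace.comap x inferInstance]) ω ≤ C * q ^ t := by
  have hn0 : (0 : ℝ) < n i := by exact_mod_cast hn
  have hcα : c ≤ α := hα ▸ le_add_of_nonneg_left (by positivity)
  have hα0 : 0 < α := hc.trans_le hcα
  have hζα : ζ * α ^ 2 < c := (lt_div_iff₀ (by positivity)).1 hζ'
  have hαc : c ^ 2 ≤ α ^ 2 := pow_le_pow_left₀ hc.le hcα 2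
  have hκ0 : 0 ≤ 1 - 2 * c * ζ + ζ ^ 2 * α ^ 2 := HierarchicalGame.contraction_rate_nonneg hαc
  -- The surplus `ζ²α²` of `q` over the contraction factor is the room that absorbs the sampling
  -- noise.
  have hqκ : q = (1 - 2 * c * ζ + ζ ^ 2 * α ^ 2) + ζ ^ 2 * α ^ 2 := by rw [hq]; ring
  have hζα2 : 0 < ζ ^ 2 * α ^ 2 := by positivity
  have hq0 : 0 < q := by linarith
  have hκ1 : 1 - 2 * c * ζ + ζ ^ 2 * α ^ 2 < 1 := by nlinarith
  obtain ⟨R, hR⟩ := hX.exists_norm_le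
  set κ := 1 - 2 * c * ζ + ζ ^ 2 * α ^ 2 with hκ
  set K : ℝ := (n i / η) ^ 2 * (2 * M + 2 * (c / 2 * (2 * R + η) ^ 2) ^ 2) with hK
  have hK0 : 0 ≤ K := by positivity
  have hvm := HierarchicalGame.measurable_indicator_minimizer (G := G) hn hη hc.le hX hmeas hmom hLip hconv hζ.le
    (by rw [← hα]; exact hκ1) vstar hvstar
  -- `(R + R)²` bounds the initial error, `1` ensures positivity, and `K q / α²` gives `K q ≤ C α²`,
  -- as the induction step requires.
  refine ⟨(R + R) ^ 2 + 1 + K * q / α ^ 2, by positivity, ?_⟩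
  set C := (R + R) ^ 2 + 1 + K * q / α ^ 2 with hC
  have hCK : K * q ≤ C * α ^ 2 := by
    rw [hC, add_mul, div_mul_cancel₀ _ (by positivity)]
    exact le_add_of_nonneg_left (by positivity)
  intro Ω _ μ _ x v₀ ξ s hx hxs hv₀ hv₀X hξ hs hlaw hind hindx v hv t
  set B : ℕ → ℕ := fun k => ⌈(q ^ (k + 1))⁻¹⌉₊ with hB
  have hBpos : ∀ k, 0 < B k := fun k => Nat.ceil_pos.2 (by positivity)
  have hvX : ∀ t ω, v t ω ∈ G.X i := fun t ω => by
    rw [hv]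
    cases t with
    | zero => exact hv₀X ω
    | succ t => exact euclProj_mem (G.X_nonempty i) (G.X_closed i) (G.X_convex i) _
  have hv0 : v 0 = v₀ := funext fun ω => by rw [hv]; rfl
  have hstep : ∀ t ω, v (t + 1) ω = euclProj (G.X i) (v t ω - ζ • ((B t : ℝ)⁻¹ •
      ∑ j ∈ Finset.range (B t),
        G.extGrad i η c (x ω) (v t ω) (ξ t j ω, s t j ω))) := fun t ω => by
    simp only [HierarchicalGame.extGrad_eq_sampleGrad hη.le (hxs ω) (hvX t ω)]
    rw [hv (t + 1), HierarchicalGame.zsol, ← hv t]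
    rfl
  have hW : ∀ p : ℕ × ℕ, Measurable fun ω => (ξ p.1 p.2 ω, s p.1 p.2 ω) := fun p =>
    (hξ _ _).prodMk (hs _ _)
  have hvmeas : Measurable (v t) := by
    obtain ⟨V, hV, hvV⟩ := HierarchicalGame.exists_measurable_factor
      (W := fun (p : ℕ × ℕ) ω => (ξ p.1 p.2 ω, s p.1 p.2 ω)) hmeas hv0 hstep t
    rw [funext hvV]
    exact hV.comp ((hx.prodMk hv₀).prodMk (measurable_pi_lambda _ fun p => hW p))
  have hvsm : Measurable fun ω => vstar (x ω) := by
    have h := hvm.comp hx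
    simpa only [Function.comp_def, fun ω => indicator_of_mem (hxs ω) vstar] using h
  have hbdd : ∀ t ω, ‖v t ω - vstar (x ω)‖ ^ 2 ≤ (R + R) ^ 2 := fun t ω =>
    pow_le_pow_left₀ (norm_nonneg _) ((norm_sub_le _ _).trans
      (add_le_add (hR _ (hvX t ω)) (hR _ (hvstar _ (hxs ω)).1))) 2
  have hint : Integrable (fun ω => ‖v t ω - vstar (x ω)‖ ^ 2) μ :=
    Integrable.of_bound ((hvmeas.sub hvsm).norm.pow_const 2).aestronglyMeasurable
      ((R + R) ^ 2) (.of_forall fun ω => by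
        rw [Real.norm_of_nonneg (sq_nonneg _)]; exact hbdd t ω)
  refine ⟨hint, condExp_le_const_of_forall_setIntegral_le hx.comap_le hint ?_⟩
  rintro _ ⟨A, hA, rfl⟩
  clear hint hvmeas
  induction t with
  | zero =>
    refine (Real.le_norm_self _).trans ((norm_setIntegral_le_of_norm_le_const (C := (R + R) ^ 2)
      (measure_lt_top _ _) fun ω _ => ?_).trans ?_)
    · rw [Real.norm_of_nonneg (sq_nonneg _)]; exact hbdd 0 ω
    · rw [pow_zero, mul_one]
      refine mul_le_mul_of_nonneg_right ?_ measureReal_nonneg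
      have : 0 ≤ K * q / α ^ 2 := by positivity
      linarith
  | succ t ih =>
    have h := HierarchicalGame.setIntegral_norm_scheme_sub_minimizer_sq_le
      (W := fun (p : ℕ × ℕ) ω => (ξ p.1 p.2 ω, s p.1 p.2 ω)) hn hη hc.le hX hR hmeas hmom hLip
      hconv hζ.le hvm hvstar hx hxs hv₀ hW (fun p => hlaw p.1 p.2) hind hindx hBpos hv0 hvX hstep
      t hA
    rw [← hα, ← hκ, ← hK] at h
    -- The exponent `t + 1` in the batch size puts the noise of step `t` directly on the scale of
    -- the target `q ^ (t + 1)`.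
    have hBinv : ζ ^ 2 * K / B t ≤ ζ ^ 2 * K * q ^ (t + 1) := by
      rw [div_eq_mul_inv]
      refine mul_le_mul_of_nonneg_left ?_ (by positivity)
      exact inv_le_of_inv_le₀ (by positivity) (Nat.le_ceil _)
    have hrate : κ * (C * q ^ t) + ζ ^ 2 * K * q ^ (t + 1) ≤ C * q ^ (t + 1) := by
      have e : C * q ^ (t + 1) - (κ * (C * q ^ t) + ζ ^ 2 * K * q ^ (t + 1)) =
          ζ ^ 2 * q ^ t * (C * α ^ 2 - K * q) := by
        rw [pow_succ]
        linear_combination C * q ^ t * hqκ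
      have : 0 ≤ ζ ^ 2 * q ^ t * (C * α ^ 2 - K * q) :=
        mul_nonneg (by positivity) (sub_nonneg.2 hCK)
      linarith
    have hm0 : 0 ≤ μ.real (x ⁻¹' A) := measureReal_nonneg
    calc _ ≤ _ := h
      _ ≤ κ * (C * q ^ t * μ.real (x ⁻¹' A)) + ζ ^ 2 * K * q ^ (t + 1) * μ.real (x ⁻¹' A) := by
        gcongr
      _ = (κ * (C * q ^ t) + ζ ^ 2 * K * q ^ (t + 1)) * μ.real (x ⁻¹' A) := by ring
      _ ≤ _ := by gcongr
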